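/- **Setting.** Let $\mathbf U=(D,\mathbf m,\mathbf B,E)$ with $D,E\in\mathbb R$ and $\mathbf m,\mathbf B\in\mathbb R^3$. Put $m=|\mathbf m|$, $B=|\mathbf B|$, $\tau=\mathbf m\cdot\mathbf B$, and $$\Phi=\sqrt{(B^2-E)^2+3(E^2-D^2-m^2)},\qquad \Psi=(\Phi-2(B^2-E))\sqrt{\Phi+B^2-E}-\sqrt{\tfrac{27}{2}(D^2B^2+\tau^2)} .$$ Assume that $\mathbf U$ is admissible: $\mathbf U\in\mathcal G=\{D>0,\ E-\sqrt{D^2+m^2}>0,\ \Psi>0\}$. Define $$f_a(\xi)=\xi^2(\xi+B^2)^2-\bigl(\xi^2m^2+(2\xi+B^2)\tau^2\bigr),\quad f_b(\xi)=f_a(\xi)-D^2(\xi+B^2)^2,\quad f_c(\xi)=\xi^3+(B^2-E)\xi^2-\tfrac12(B^2D^2+\tau^2),$$ $\Omega_1=\{\xi>0:\ f_a(\xi)>0\}$, $\xi_d=\frac13(\Phi-2(B^2-E))$, and for $\xi\in\Omega_1$ $$\mathcal W(\xi)=\frac{\xi(\xi+B^2)}{\sqrt{f_a(\xi)}},\quad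 \rho(\xi)=\frac{D}{\mathcal W(\xi)},\quad h(\xi)=\frac{\xi}{D\,\mathcal W(\xi)},\quad \mathbf v(\xi)=\frac{\mathbf m+\xi^{-1}\tau\mathbf B}{\xi+B^2}.$$ An equation of state (EOS) $h=\mathcal H(\rho,p)$ is *causal* if on $\{\rho,p>0\}$ the function $\mathcal H$ is differentiable, $\mathcal H\ge\sqrt{1+p^2/\rho^2}+p/\rho$, $\ \mathcal H\,(1/\rho-\partial_p\mathcal H)<\partial_\rho\mathcal H<0$, and $\lim_{p\to0^+}\mathcal H(\rho,p)=1$ for every $\rho>0$. Let $p=\mathcal P(\rho,h)$ be the same EOS solved for $p$, i.e. $p=\mathcal P(\rho,h)\Leftrightarrow h=\mathcal H(\rho,p)$ for all $\rho,p>0$ and all $h\in\mathbb R$. Put $p(\xi)=\mathcal P(\rho(\xi),h(\xi))$ and $$\mathcal F(\xi)=\xi-p(\xi)-\frac12\Bigl(\frac{B^2}{\mathcal W(\xi)^2}+\frac{\tau^2}{\xi^2}\Bigr)+B^2-E .$$ **Theorem.** The polynomial $f_b$ has a unique root $\xi_b$ in $\Omega_1$, and $f_c$ has a unique positive root $\xi_c$.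 Consider either 1. the $\gamma$-law EOS $\mathcal H(\rho,p)=1+\frac{\gamma p}{(\gamma-1)\rho}$ with $\gamma\in(1,2]$; or 2. a causal EOS such that $\mathcal F'$ is monotone (increasing or decreasing) on $(\xi_b,\infty)$, or there is $\xi_{in}>\xi_b$ such that $\mathcal F'$ is decreasing on $(\xi_b,\xi_{in}]$ and increasing on $[\xi_{in},\infty)$ (all in the weak sense). Then $\mathcal F$ has a unique root $\xi_*$ in $(\xi_b,\infty)$. Let the initial guess be either the hybrid one, $\xi_0=\xi_d$ if $\mathcal F(\xi_d)\le0$ and $\xi_0=\xi_c$ otherwise, or simply $\xi_0=\xi_c$. Then the Newton–Raphson iteration $\xi_{n+1}=\xi_n-\mathcal F(\xi_n)/\mathcal F'(\xi_n)$ is well defined ($\mathcal F'(\xi_n)$ exists and is nonzero for all $n$), it is physical-constraint-preserving (PCP), that is, $$\xi_n\in\Omega_1,\quad \rho(\xi_n)>0,\quad p(\xi_n)>0,\quad |\mathbf v(\xi_n)|<1\qquad\text{for all } n\ge0,$$ and it converges: $\lim_{n\to\infty}\xi_n=\xi_*$. Moreover, in case 1, and in case 2 if $\mathcal H$ is twice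 differentiable on $\{\rho,p>0\}$, the convergence is (at least) quadratic: there is a constant $C>0$ with $|\xi_{n+1}-\xi_*|\le C\,|\xi_n-\xi_*|^2$ for all $n\ge0$. -/

import Mathlib

open Filter Set Topology

noncomputable section

namespace RMHD

/-- A conservative vector `U = (D, m, B, E)` of relativistic magnetohydrodynamics. -/
structure ConsState where
  D : ℝ
  m : EuclideanSpace ℝ (Fin 3)
  B : EuclideanSpace ℝ (Fin 3)
  E : ℝ

namespace ConsState

variable (U : ConsState)

/-- `τ = m · B`. -/
def tau : ℝ := inner ℝ U.m U.B

/-- `Φ(U)`. -/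
def Phi : ℝ :=
  √((‖U.B‖ ^ 2 - U.E) ^ 2 + 3 * (U.E ^ 2 - U.D ^ 2 - ‖U.m‖ ^ 2))

/-- `Ψ(U)`. -/
def Psi : ℝ :=
  (U.Phi - 2 * (‖U.B‖ ^ 2 - U.E)) * √(U.Phi + ‖U.B‖ ^ 2 - U.E)
    - √(27 / 2 * (U.D ^ 2 * ‖U.B‖ ^ 2 + U.tau ^ 2))

/-- The set `𝒢` of physically admissible conservative vectors. -/
def admissible : Set ConsState :=
  {U | 0 < U.D ∧ 0 < U.E - √(U.D ^ 2 + ‖U.m‖ ^ 2) ∧ 0 < U.Psi}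

/-- The quartic polynomial `f_a`. -/
def fa (ξ : ℝ) : ℝ :=
  ξ ^ 2 * (ξ + ‖U.B‖ ^ 2) ^ 2
    - (ξ ^ 2 * ‖U.m‖ ^ 2 + (2 * ξ + ‖U.B‖ ^ 2) * U.tau ^ 2)

/-- The quartic polynomial `f_b`. -/
def fb (ξ : ℝ) : ℝ := U.fa ξ - U.D ^ 2 * (ξ + ‖U.B‖ ^ 2) ^ 2

/-- The cubic polynomial `f_c`. -/
def fc (ξ : ℝ) : ℝ :=
  ξ ^ 3 + (‖U.B‖ ^ 2 - U.E) * ξ ^ 2 - (‖U.B‖ ^ 2 * U.D ^ 2 + U.tau ^ 2) / 2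

/-- `Ω₁`: the positive `ξ` at which the Lorentz factor is well defined. -/
def Omega1 : Set ℝ := {ξ | 0 < ξ ∧ 0 < U.fa ξ}

/-- The Lorentz factor `𝒲(ξ)`. -/
def W (ξ : ℝ) : ℝ := ξ * (ξ + ‖U.B‖ ^ 2) / √(U.fa ξ)

/-- The velocity `v(ξ)` recovered from `ξ`. -/
def vel (ξ : ℝ) : EuclideanSpace ℝ (Fin 3) :=
  (ξ + ‖U.B‖ ^ 2)⁻¹ • (U.m + (ξ⁻¹ * U.tau) • U.B)

/-- The rest-mass density `ρ(ξ)` recovered from `ξ`. -/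
def dens (ξ : ℝ) : ℝ := U.D / U.W ξ

/-- The specific enthalpy `h(ξ)` recovered from `ξ`. -/
def enth (ξ : ℝ) : ℝ := ξ / (U.D * U.W ξ)

/-- The pressure `p(ξ)` recovered from `ξ`, for the equation of state `p = P(ρ, h)`. -/
def pres (P : ℝ → ℝ → ℝ) (ξ : ℝ) : ℝ := P (U.dens ξ) (U.enth ξ)

/-- The iterative function `ℱ(ξ)` for the equation of state `p = P(ρ, h)`. -/
def F (P : ℝ → ℝ → ℝ) (ξ : ℝ) : ℝ :=
  ξ - U.pres P ξ - (‖U.B‖ ^ 2 / U.W ξ ^ 2 + U.tau ^ 2 / ξ ^ 2) / 2 + (‖U.B‖ ^ 2 - U.E)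

/-- The explicit initial guess `ξ_d`. -/
def xid : ℝ := (U.Phi - 2 * (‖U.B‖ ^ 2 - U.E)) / 3

/-- The hybrid initial guess: `ξ_d` if `ℱ(ξ_d) ≤ 0`, and `ξ_c` otherwise. -/
def hybrid (P : ℝ → ℝ → ℝ) (ξc : ℝ) : ℝ := if U.F P U.xid ≤ 0 then U.xid else ξc

/-- A sequence is physical-constraint-preserving: every iterate lies in `Ω₁` and yields a
positive density, a positive pressure and a subluminal velocity. -/
def PCP (P : ℝ → ℝ → ℝ) (ξ : ℕ → ℝ) : Prop :=
  ∀ n, ξ n ∈ U.Omega1 ∧ 0 < U.dens (ξ n) ∧ 0 < U.pres P (ξ n) ∧ ‖U.vel (ξ n)‖ < 1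

end ConsState

/-- Causal equations of state `h = H(ρ, p)`. Only the values of `H` for `ρ, p > 0` matter. -/
structure CausalEOS (H : ℝ → ℝ → ℝ) : Prop where
  differentiable : ∀ ρ p, 0 < ρ → 0 < p →
    DifferentiableAt ℝ (fun q : ℝ × ℝ => H q.1 q.2) (ρ, p)
  kinetic : ∀ ρ p, 0 < ρ → 0 < p → √(1 + p ^ 2 / ρ ^ 2) + p / ρ ≤ H ρ p
  causal : ∀ ρ p, 0 < ρ → 0 < p →
    H ρ p * (1 / ρ - deriv (fun p' => H ρ p') p) < deriv (fun ρ' => H ρ' p) ρ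
  expansion : ∀ ρ p, 0 < ρ → 0 < p → deriv (fun ρ' => H ρ' p) ρ < 0
  limit : ∀ ρ, 0 < ρ → Tendsto (fun p => H ρ p) (𝓝[>] 0) (𝓝 1)

/-- `h = H(ρ, p)` is rewritten as `p = P(ρ, h)`: for `ρ, p > 0` the two equations are
equivalent. -/
def IsPressureForm (H P : ℝ → ℝ → ℝ) : Prop :=
  ∀ ρ p h, 0 < ρ → 0 < p → (p = P ρ h ↔ h = H ρ p)

/-- The `γ`-law equation of state. -/
def gammaLaw (γ ρ p : ℝ) : ℝ := 1 + γ * p / ((γ - 1) * ρ)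

/-- `H` is twice differentiable on `ℝ⁺ × ℝ⁺`. -/
def TwiceDifferentiableEOS (H : ℝ → ℝ → ℝ) : Prop :=
  DifferentiableOn ℝ (fun q : ℝ × ℝ => H q.1 q.2) (Ioi 0 ×ˢ Ioi 0) ∧
  DifferentiableOn ℝ (fderiv ℝ (fun q : ℝ × ℝ => H q.1 q.2)) (Ioi 0 ×ˢ Ioi 0)

/-- `x` is the unique root of `f` in `S`. -/
def IsUniqueRoot (f : ℝ → ℝ) (S : Set ℝ) (x : ℝ) : Prop :=
  (x ∈ S ∧ f x = 0) ∧ ∀ y ∈ S, f y = 0 → y = x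

/-- `f'` is monotone on `(a, ∞)`, or it decreases on `(a, b]` and increases on `[b, ∞)` for
some `b > a`. -/
def DerivMonotoneOrOneInflection (f : ℝ → ℝ) (a : ℝ) : Prop :=
  MonotoneOn (deriv f) (Ioi a) ∨ AntitoneOn (deriv f) (Ioi a) ∨
    ∃ b, a < b ∧ AntitoneOn (deriv f) (Ioc a b) ∧ MonotoneOn (deriv f) (Ici b)

/-- The Newton--Raphson sequence for `f = 0` started at `x₀`. -/
def newton (f : ℝ → ℝ) (x₀ : ℝ) : ℕ → ℝ
  | 0 => x₀
  | n + 1 => newton f x₀ n - f (newton f x₀ n) / deriv f (newton f x₀ n)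

/-- Every Newton--Raphson step from the sequence `ξ` is a genuine one: the derivative exists
and does not vanish. -/
def NewtonWellDefined (f : ℝ → ℝ) (ξ : ℕ → ℝ) : Prop :=
  ∀ n, DifferentiableAt ℝ f (ξ n) ∧ deriv f (ξ n) ≠ 0

/-- Quadratic rate of approach of the sequence `ξ` to `x`. -/
def QuadraticRate (ξ : ℕ → ℝ) (x : ℝ) : Prop :=
  ∃ C : ℝ, 0 < C ∧ ∀ n, |ξ (n + 1) - x| ≤ C * |ξ n - x| ^ 2

end RMHD

end

/-!
Convergence of Newton's method for recovering the primitive variables in relativistic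
magnetohydrodynamics.

Split the momentum `m` into its parts along and orthogonal to `B`, of squared lengths `C` and `A`.
Then `1 / 𝒲(ξ)² = 1 - |v(ξ)|² = 1 - A / (ξ + B²)² - C / ξ²`, which is increasing in `ξ`, and
`f_b > 0` on `Ω₁` says exactly that `h(ξ) > 1`, that is, that the pressure is positive. So `(ξ_b, ∞)`
is the physical range, and every iterate that stays in it has all the required properties.

*The initial guesses.* `Ψ > 0` amounts to `f_c(ξ_d) > 0`, hence `ξ_c < ξ_d`. As `ξ_d` is the larger
solution of a quadratic equation whose left side falls short of the right side at `ξ_c` by exactly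
`f_b(ξ_c) / ξ_c²`, this gives `f_b(ξ_c) > 0`, so `ξ_b < ξ_c < ξ_d` (`fb_pos_of_fc_eq_zero`). On the
physical range `ℱ(ξ) < f_c(ξ) / ξ²` (`F_lt_fc_div`), so `ℱ(ξ_c) < 0`. Both guesses therefore start in
`(ξ_b, ξ_*]`.

*Monotonicity.* The causality condition bounds `p'(ξ)` by `1 / 𝒲² + ξ (1 / 𝒲²)' / 2`, and this
bound is exactly what makes `ℱ'` positive (`presSlope_lt`, `one_sub_slope_eq_zero`). The kinetic
bound on `H` gives `p(ξ) ≤ ξ / 2`, so `ℱ` tends to infinity and has a unique root.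

*Newton's method.* Let `f' > 0` on `(a, ∞)`, and let `f'` be monotone or first decreasing, then
increasing. Either `f` is concave on `(a, ξ_*]`, and the iterates increase to `ξ_*` without passing
it, or `f` is convex on `[ξ_*, ∞)`, and the iterates pass `ξ_*` at most once and decrease to it
afterwards (`tendsto_newton`). The rate is quadratic if `f'` is differentiable at `ξ_*`
(`quadraticRate_newton`).

*The `γ`-law.* It is causal for `1 < γ ≤ 2`. With `κ = (γ - 1) / γ ≤ 1 / 2`, `y = ξ + B²`,
`g = A / y³ + C / ξ³` and `q = A / y⁴ + C / ξ⁴`,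
`ℱ'' = G - κ D (3 q 𝒲 + g² 𝒲³)` where `G = 2 κ g + (3 - 6 κ) B² A / y⁴ ≥ 0`. The ratios `q / G` and
`g² / G` decrease in `ξ`, and so does `𝒲`. Hence `ℱ''` changes sign at most once, from negative to
positive, and the general result applies (`derivMonotoneOrOneInflection_F_gammaLaw`).
-/

namespace RMHD

/-! ### Convergence of Newton's method for an increasing function with one inflection -/

lemma newton_succ (f : ℝ → ℝ) (x₀ : ℝ) (n : ℕ) :
    newton f x₀ (n + 1) =
      newton f x₀ n - f (newton f x₀ n) / deriv f (newton f x₀ n) := rfl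

lemma newton_add (f : ℝ → ℝ) (x₀ : ℝ) (N n : ℕ) :
    newton f x₀ (N + n) = newton f (newton f x₀ N) n := by
  induction n with
  | zero => rfl
  | succ n ih => rw [← add_assoc, newton_succ, newton_succ, ih]

section Newton

variable {f : ℝ → ℝ} {a s : ℝ}

lemma strictMonoOn_Ioi_of_deriv_pos (hd : ∀ x, a < x → DifferentiableAt ℝ f x)
    (hpos : ∀ x, a < x → 0 < deriv f x) : StrictMonoOn f (Ioi a) := by
  refine strictMonoOn_of_deriv_pos (convex_Ioi a)
    (fun x hx => (hd x hx).continuousAt.continuousWithinAt) fun x hx => ?_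
  rw [interior_Ioi] at hx
  exact hpos x hx

/-- The mean value theorem between two points of `(a, ∞)`, in either order. -/
lemma exists_deriv_mul_sub_eq (hd : ∀ x, a < x → DifferentiableAt ℝ f x) {x y : ℝ}
    (hx : a < x) (hxy : x < y) :
    ∃ η, x < η ∧ η < y ∧ f y - f x = deriv f η * (y - x) := by
  obtain ⟨η, hη, h⟩ := exists_deriv_eq_slope f hxy
    (fun z hz => (hd z (hx.trans_le hz.1)).continuousAt.continuousWithinAt)
    (fun z hz => (hd z (hx.trans hz.1)).differentiableWithinAt)
  refine ⟨η, hη.1, hη.2, ?_⟩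
  rw [h, div_mul_cancel₀ _ (sub_ne_zero.2 hxy.ne')]

/-- A Newton sequence that converges inside `(a, ∞)` with bounded slopes converges to the
root. -/
lemma limit_eq_root_of_tendsto_newton (hd : ∀ x, a < x → DifferentiableAt ℝ f x)
    (hpos : ∀ x, a < x → 0 < deriv f x) (has : a < s) (hs : f s = 0) {x₀ l M : ℝ}
    (hx : ∀ n, a < newton f x₀ n) (hM : ∀ n, deriv f (newton f x₀ n) ≤ M)
    (hal : a < l) (hl : Tendsto (newton f x₀) atTop (𝓝 l)) : l = s := by
  have hfl : Tendsto (fun n => f (newton f x₀ n)) atTop (𝓝 (f l)) :=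
    (hd l hal).continuousAt.tendsto.comp hl
  have hstep : Tendsto (fun n => M * |newton f x₀ (n + 1) - newton f x₀ n|) atTop (𝓝 0) := by
    have h := (((tendsto_add_atTop_iff_nat 1).2 hl).sub hl).abs.const_mul M
    simpa using h
  have h0 : Tendsto (fun n => f (newton f x₀ n)) atTop (𝓝 0) := by
    refine squeeze_zero_norm (fun n => ?_) hstep
    have hp := hpos _ (hx n)
    have : f (newton f x₀ n) =
        -(newton f x₀ (n + 1) - newton f x₀ n) * deriv f (newton f x₀ n) := by
      rw [newton_succ]; field_simp; ring
    rw [this, Real.norm_eq_abs, abs_mul, abs_neg, abs_of_pos hp, mul_comm]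
    exact mul_le_mul_of_nonneg_right (hM n) (abs_nonneg _)
  have hfl0 : f l = 0 := tendsto_nhds_unique hfl h0
  exact (strictMonoOn_Ioi_of_deriv_pos hd hpos).injOn hal has (hfl0.trans hs.symm)

lemma newton_step_ge_of_le (hd : ∀ x, a < x → DifferentiableAt ℝ f x)
    (hpos : ∀ x, a < x → 0 < deriv f x) (hs : f s = 0) {x : ℝ}
    (hax : a < x) (hxs : x ≤ s) : x ≤ x - f x / deriv f x := by
  have : f x ≤ 0 := hs ▸
    (strictMonoOn_Ioi_of_deriv_pos hd hpos).monotoneOn hax (hax.trans_le hxs) hxs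
  have := div_nonpos_of_nonpos_of_nonneg this (hpos x hax).le
  linarith

lemma newton_step_le_of_ge (hd : ∀ x, a < x → DifferentiableAt ℝ f x)
    (hpos : ∀ x, a < x → 0 < deriv f x) (has : a < s) (hs : f s = 0) {x : ℝ}
    (hxs : s ≤ x) : x - f x / deriv f x ≤ x := by
  have : 0 ≤ f x := hs ▸
    (strictMonoOn_Ioi_of_deriv_pos hd hpos).monotoneOn has (has.trans_le hxs) hxs
  have := div_nonneg this (hpos x (has.trans_le hxs)).le
  linarith

/-- Where `f` is concave to the left of the root, a Newton step from the left does not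
overshoot. -/
lemma newton_step_le_root (hd : ∀ x, a < x → DifferentiableAt ℝ f x)
    (hpos : ∀ x, a < x → 0 < deriv f x) (hs : f s = 0)
    (hanti : AntitoneOn (deriv f) (Ioc a s)) {x : ℝ}
    (hax : a < x) (hxs : x ≤ s) : x - f x / deriv f x ≤ s := by
  rcases hxs.eq_or_lt with rfl | hlt
  · simp [hs]
  obtain ⟨η, h1, h2, h3⟩ := exists_deriv_mul_sub_eq hd hax hlt
  have h4 := hanti ⟨hax, hxs⟩ ⟨hax.trans h1, h2.le⟩ h1.le
  have h5 : -(f x) ≤ deriv f x * (s - x) := by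
    rw [hs] at h3
    nlinarith [mul_le_mul_of_nonneg_right h4 (sub_nonneg.2 hxs)]
  have h6 : -(f x / deriv f x) ≤ s - x := by
    rw [← neg_div, div_le_iff₀ (hpos x hax)]; linarith
  linarith

/-- Where `f` is convex to the right of the root, a Newton step from the right stays there. -/
lemma root_le_newton_step (hd : ∀ x, a < x → DifferentiableAt ℝ f x)
    (hpos : ∀ x, a < x → 0 < deriv f x) (has : a < s) (hs : f s = 0)
    (hmono : MonotoneOn (deriv f) (Ici s)) {x : ℝ} (hxs : s ≤ x) :
    s ≤ x - f x / deriv f x := by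
  rcases hxs.eq_or_lt with rfl | hlt
  · simp [hs]
  obtain ⟨η, h1, h2, h3⟩ := exists_deriv_mul_sub_eq hd has hlt
  have h4 := hmono h1.le hxs h2.le
  have h5 : f x ≤ deriv f x * (x - s) := by
    rw [hs] at h3
    nlinarith [mul_le_mul_of_nonneg_right h4 (sub_nonneg.2 hxs)]
  have h6 : f x / deriv f x ≤ x - s := by
    rw [div_le_iff₀ (hpos x (has.trans_le hxs))]; linarith
  linarith

/-- At the root, one of the two one-sided shapes that control Newton's method is present. -/
lemma DerivMonotoneOrOneInflection.antitoneOn_or_monotoneOn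
    (h : DerivMonotoneOrOneInflection f a) (has : a < s) :
    AntitoneOn (deriv f) (Ioc a s) ∨ MonotoneOn (deriv f) (Ici s) := by
  rcases h with h | h | ⟨b, hab, h1, h2⟩
  · exact Or.inr (h.mono fun x hx => has.trans_le hx)
  · exact Or.inl (h.mono fun x hx => hx.1)
  · rcases le_total s b with hsb | hsb
    · exact Or.inl (h1.mono fun x hx => ⟨hx.1, hx.2.trans hsb⟩)
    · exact Or.inr (h2.mono fun x hx => hsb.trans hx)

lemma DerivMonotoneOrOneInflection.deriv_le_max
    (h : DerivMonotoneOrOneInflection f a) {x₀ x : ℝ} (hax : a < x₀)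
    (hx : x₀ ≤ x) (hxs : x ≤ s) : deriv f x ≤ max (deriv f x₀) (deriv f s) := by
  have hax' := hax.trans_le hx
  rcases h with h | h | ⟨b, hab, h1, h2⟩
  · exact le_max_of_le_right (h hax' (hax'.trans_le hxs) hxs)
  · exact le_max_of_le_left (h hax hax' hx)
  · rcases le_total x b with hxb | hxb
    · exact le_max_of_le_left (h1 ⟨hax, hx.trans hxb⟩ ⟨hax', hxb⟩ hx)
    · exact le_max_of_le_right (h2 hxb (hxb.trans hxs) hxs)

/-- Newton's method converges monotonically when it is started in a convex region to the right
of the root. -/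
lemma tendsto_newton_of_root_le (hd : ∀ x, a < x → DifferentiableAt ℝ f x)
    (hpos : ∀ x, a < x → 0 < deriv f x) (has : a < s) (hs : f s = 0)
    (hmono : MonotoneOn (deriv f) (Ici s)) {x₀ : ℝ} (hx₀ : s ≤ x₀) :
    Tendsto (newton f x₀) atTop (𝓝 s) := by
  have hge : ∀ n, s ≤ newton f x₀ n := fun n => by
    induction n with
    | zero => exact hx₀
    | succ n ih => exact root_le_newton_step hd hpos has hs hmono ih
  have hanti : Antitone (newton f x₀) :=
    antitone_nat_of_succ_le fun n => newton_step_le_of_ge hd hpos has hs (hge n)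
  have hl := tendsto_atTop_ciInf hanti ⟨s, by rintro _ ⟨n, rfl⟩; exact hge n⟩
  have hsl : s ≤ ⨅ n, newton f x₀ n := le_ciInf hge
  rwa [limit_eq_root_of_tendsto_newton hd hpos has hs (fun n => has.trans_le (hge n))
    (fun n => hmono (hge n) hx₀ (hanti (Nat.zero_le n))) (has.trans_le hsl) hl] at hl

/-- Newton's method converges monotonically as long as its iterates do not pass the root. -/
lemma tendsto_newton_of_forall_le (hd : ∀ x, a < x → DifferentiableAt ℝ f x)
    (hpos : ∀ x, a < x → 0 < deriv f x) (has : a < s) (hs : f s = 0)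
    (hshape : DerivMonotoneOrOneInflection f a) {x₀ : ℝ} (hx : ∀ n, a < newton f x₀ n)
    (hle : ∀ n, newton f x₀ n ≤ s) : Tendsto (newton f x₀) atTop (𝓝 s) := by
  have hmono : Monotone (newton f x₀) :=
    monotone_nat_of_le_succ fun n => newton_step_ge_of_le hd hpos hs (hx n) (hle n)
  have hbdd : BddAbove (range (newton f x₀)) := ⟨s, by rintro _ ⟨n, rfl⟩; exact hle n⟩
  have hl := tendsto_atTop_ciSup hmono hbdd
  have hxl : x₀ ≤ ⨆ n, newton f x₀ n := le_ciSup hbdd 0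
  rwa [limit_eq_root_of_tendsto_newton hd hpos has hs hx
    (fun n => hshape.deriv_le_max (hx 0) (hmono (Nat.zero_le n)) (hle n))
    ((hx 0).trans_le hxl) hl] at hl

/-- Newton's method started in `(a, s]` stays in `(a, ∞)`: it can pass the root `s` only into a
region of convexity, from which it does not return. -/
lemma lt_newton (hd : ∀ x, a < x → DifferentiableAt ℝ f x)
    (hpos : ∀ x, a < x → 0 < deriv f x) (has : a < s) (hs : f s = 0)
    (hshape : DerivMonotoneOrOneInflection f a) {x₀ : ℝ} (hx₀ : a < x₀) (hx₀s : x₀ ≤ s)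
    (n : ℕ) : a < newton f x₀ n := by
  rcases hshape.antitoneOn_or_monotoneOn has with h | h
  · suffices a < newton f x₀ n ∧ newton f x₀ n ≤ s from this.1
    induction n with
    | zero => exact ⟨hx₀, hx₀s⟩
    | succ n ih =>
      exact ⟨ih.1.trans_le (newton_step_ge_of_le hd hpos hs ih.1 ih.2),
        newton_step_le_root hd hpos hs h ih.1 ih.2⟩
  · induction n with
    | zero => exact hx₀
    | succ n ih =>
      rcases le_total (newton f x₀ n) s with hle | hle
      · exact ih.trans_le (newton_step_ge_of_le hd hpos hs ih hle)
      · exact has.trans_le (root_le_newton_step hd hpos has hs h hle)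

theorem tendsto_newton (hd : ∀ x, a < x → DifferentiableAt ℝ f x)
    (hpos : ∀ x, a < x → 0 < deriv f x) (has : a < s) (hs : f s = 0)
    (hshape : DerivMonotoneOrOneInflection f a) {x₀ : ℝ} (hx₀ : a < x₀) (hx₀s : x₀ ≤ s) :
    Tendsto (newton f x₀) atTop (𝓝 s) := by
  have hx := lt_newton hd hpos has hs hshape hx₀ hx₀s
  rcases hshape.antitoneOn_or_monotoneOn has with h | h
  · refine tendsto_newton_of_forall_le hd hpos has hs hshape hx fun n => ?_
    induction n with
    | zero => exact hx₀s
    | succ n ih => exact newton_step_le_root hd hpos hs h (hx n) ih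
  · by_cases hle : ∀ n, newton f x₀ n ≤ s
    · exact tendsto_newton_of_forall_le hd hpos has hs hshape hx hle
    · push Not at hle
      obtain ⟨N, hN⟩ := hle
      have := tendsto_newton_of_root_le hd hpos has hs h hN.le
      rw [← tendsto_add_atTop_iff_nat N]
      refine this.congr fun n => ?_
      rw [add_comm, newton_add]

/-- One Newton step squares the error up to a constant near a simple root at which `f'` is
differentiable. -/
lemma eventually_newton_step_le (hd : ∀ x, a < x → DifferentiableAt ℝ f x)
    (hpos : ∀ x, a < x → 0 < deriv f x) (has : a < s) (hs : f s = 0)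
    (h2 : DifferentiableAt ℝ (deriv f) s) :
    ∃ C, ∀ᶠ x in 𝓝 s, |x - f x / deriv f x - s| ≤ C * |x - s| ^ 2 := by
  obtain ⟨L, hL⟩ := h2.isBigO_sub.bound
  have hc : ∀ᶠ x in 𝓝 s, deriv f s / 2 < deriv f x :=
    h2.continuousAt.eventually (lt_mem_nhds (half_lt_self (hpos s has)))
  obtain ⟨ε, hε, hball⟩ := Metric.eventually_nhds_iff.1 hL
  refine ⟨2 * (|L| + |L|) / deriv f s, ?_⟩
  filter_upwards [hc, Metric.ball_mem_nhds s hε, lt_mem_nhds has] with x hx1 hx2 hx3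
  have hp := hpos s has
  have hL' : ∀ z, |z - s| ≤ |x - s| → |deriv f z - deriv f s| ≤ |L| * |x - s| := fun z hz => by
    have h := hball (show dist z s < ε from hz.trans_lt hx2)
    simp only [Real.norm_eq_abs] at h
    exact h.trans (mul_le_mul (le_abs_self L) hz (abs_nonneg _) (abs_nonneg _))
  obtain ⟨η, hη, hfx⟩ : ∃ η, |η - s| ≤ |x - s| ∧ f x = deriv f η * (x - s) := by
    rcases lt_trichotomy x s with h | h | h
    · obtain ⟨η, h3, h4, h5⟩ := exists_deriv_mul_sub_eq hd hx3 h
      refine ⟨η, ?_, by rw [hs] at h5; linarith⟩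
      rw [abs_of_neg (sub_neg.2 h4), abs_of_neg (sub_neg.2 h)]; linarith
    · exact ⟨s, by simp, by simp [h, hs]⟩
    · obtain ⟨η, h3, h4, h5⟩ := exists_deriv_mul_sub_eq hd has h
      refine ⟨η, ?_, by rw [hs] at h5; linarith⟩
      rw [abs_of_pos (sub_pos.2 h3), abs_of_pos (sub_pos.2 h)]; linarith
  have hx0 : 0 < deriv f x := (half_pos hp).trans hx1
  have hxp : x - f x / deriv f x - s = (deriv f x - deriv f η) * (x - s) / deriv f x := by
    rw [hfx]; field_simp; ring
  have h6 : |deriv f x - deriv f η| ≤ (|L| + |L|) * |x - s| := by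
    have e : deriv f x - deriv f η = (deriv f x - deriv f s) - (deriv f η - deriv f s) := by ring
    rw [e, add_mul]
    exact (abs_sub _ _).trans (add_le_add (hL' x le_rfl) (hL' η hη))
  rw [hxp, abs_div, abs_mul, abs_of_pos hx0, div_le_iff₀ hx0]
  have h7 : |deriv f x - deriv f η| * |x - s| ≤ (|L| + |L|) * |x - s| ^ 2 := by
    rw [pow_two, ← mul_assoc]
    exact mul_le_mul_of_nonneg_right h6 (abs_nonneg _)
  refine h7.trans ?_
  have h8 : (|L| + |L|) * |x - s| ^ 2 =
      2 * (|L| + |L|) / deriv f s * |x - s| ^ 2 * (deriv f s / 2) := by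
    field_simp
  rw [h8]
  exact mul_le_mul_of_nonneg_left hx1.le (by positivity)

theorem quadraticRate_newton (hd : ∀ x, a < x → DifferentiableAt ℝ f x)
    (hpos : ∀ x, a < x → 0 < deriv f x) (has : a < s) (hs : f s = 0)
    (h2 : DifferentiableAt ℝ (deriv f) s) {x₀ : ℝ}
    (hlim : Tendsto (newton f x₀) atTop (𝓝 s)) : QuadraticRate (newton f x₀) s := by
  obtain ⟨C, hC⟩ := eventually_newton_step_le hd hpos has hs h2
  obtain ⟨N, hN⟩ := eventually_atTop.1 (hlim.eventually hC)
  -- The finitely many steps before the asymptotic regime are absorbed into the constant.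
  let r : ℕ → ℝ := fun n => |newton f x₀ (n + 1) - s| / |newton f x₀ n - s| ^ 2
  have hr : ∀ n, 0 ≤ r n := fun n => by positivity
  have hsum : 0 ≤ ∑ n ∈ Finset.range N, r n := Finset.sum_nonneg fun n _ => hr n
  refine ⟨|C| + ∑ n ∈ Finset.range N, r n + 1, by positivity, fun n => ?_⟩
  rcases le_or_gt N n with hn | hn
  · refine (hN n hn).trans (mul_le_mul_of_nonneg_right ?_ (by positivity))
    linarith [le_abs_self C]
  · by_cases h0 : newton f x₀ n = s
    · rw [newton_succ, h0, hs]; simp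
    · have hne : 0 < |newton f x₀ n - s| ^ 2 := by
        have := abs_pos.2 (sub_ne_zero.2 h0); positivity
      have h1 : |newton f x₀ (n + 1) - s| = r n * |newton f x₀ n - s| ^ 2 :=
        (div_mul_cancel₀ _ hne.ne').symm
      rw [h1]
      refine mul_le_mul_of_nonneg_right ?_ hne.le
      have := Finset.single_le_sum (f := r) (fun i _ => hr i) (Finset.mem_range.2 hn)
      linarith [abs_nonneg C]

end Newton

/-! ### Causal equations of state solved for the pressure -/

namespace CausalEOS

variable {H P : ℝ → ℝ → ℝ} {ρ p h : ℝ}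

lemma hasDerivAt_density (hH : CausalEOS H) (hρ : 0 < ρ) (hp : 0 < p) :
    HasDerivAt (fun ρ' => H ρ' p)
      (fderiv ℝ (fun q : ℝ × ℝ => H q.1 q.2) (ρ, p) (1, 0)) ρ :=
  (hH.differentiable ρ p hρ hp).hasFDerivAt.comp_hasDerivAt (f := fun t => (t, p)) ρ
    ((hasDerivAt_id ρ).prodMk (hasDerivAt_const ρ p))

lemma hasDerivAt_pressure (hH : CausalEOS H) (hρ : 0 < ρ) (hp : 0 < p) :
    HasDerivAt (fun p' => H ρ p')
      (fderiv ℝ (fun q : ℝ × ℝ => H q.1 q.2) (ρ, p) (0, 1)) p :=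
  (hH.differentiable ρ p hρ hp).hasFDerivAt.comp_hasDerivAt (f := fun t => (ρ, t)) p
    ((hasDerivAt_const p ρ).prodMk (hasDerivAt_id p))

lemma enthalpy_pos (hH : CausalEOS H) (hρ : 0 < ρ) (hp : 0 < p) : 0 < H ρ p :=
  (by positivity : 0 < √(1 + p ^ 2 / ρ ^ 2) + p / ρ).trans_le (hH.kinetic ρ p hρ hp)

lemma fderiv_density_neg (hH : CausalEOS H) (hρ : 0 < ρ) (hp : 0 < p) :
    fderiv ℝ (fun q : ℝ × ℝ => H q.1 q.2) (ρ, p) (1, 0) < 0 :=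
  (hH.hasDerivAt_density hρ hp).deriv ▸ hH.expansion ρ p hρ hp

lemma mul_lt_fderiv_density (hH : CausalEOS H) (hρ : 0 < ρ) (hp : 0 < p) :
    H ρ p * (1 / ρ - fderiv ℝ (fun q : ℝ × ℝ => H q.1 q.2) (ρ, p) (0, 1)) <
      fderiv ℝ (fun q : ℝ × ℝ => H q.1 q.2) (ρ, p) (1, 0) := by
  have := hH.causal ρ p hρ hp
  rwa [(hH.hasDerivAt_density hρ hp).deriv, (hH.hasDerivAt_pressure hρ hp).deriv] at this

lemma inv_lt_fderiv_pressure (hH : CausalEOS H) (hρ : 0 < ρ) (hp : 0 < p) :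
    1 / ρ < fderiv ℝ (fun q : ℝ × ℝ => H q.1 q.2) (ρ, p) (0, 1) := by
  have h1 := (hH.mul_lt_fderiv_density hρ hp).trans (hH.fderiv_density_neg hρ hp)
  have h2 := hH.enthalpy_pos hρ hp
  by_contra! hle
  exact absurd h1 (not_lt.2 (mul_nonneg h2.le (sub_nonneg.2 hle)))

lemma fderiv_pressure_pos (hH : CausalEOS H) (hρ : 0 < ρ) (hp : 0 < p) :
    0 < fderiv ℝ (fun q : ℝ × ℝ => H q.1 q.2) (ρ, p) (0, 1) :=
  (one_div_pos.2 hρ).trans (hH.inv_lt_fderiv_pressure hρ hp)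

lemma strictMonoOn_pressure (hH : CausalEOS H) (hρ : 0 < ρ) :
    StrictMonoOn (fun p => H ρ p) (Ioi 0) := by
  refine strictMonoOn_of_deriv_pos (convex_Ioi 0)
    (fun p hp => (hH.hasDerivAt_pressure hρ hp).continuousAt.continuousWithinAt)
    fun p hp => ?_
  rw [interior_Ioi] at hp
  rw [(hH.hasDerivAt_pressure hρ hp).deriv]
  exact hH.fderiv_pressure_pos hρ hp

lemma exists_pressure (hH : CausalEOS H) (hρ : 0 < ρ) (hh : 1 < h) :
    ∃ p, 0 < p ∧ H ρ p = h := by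
  obtain ⟨p₁, h1, hp₁⟩ := (((hH.limit ρ hρ).eventually (gt_mem_nhds hh)).and
    self_mem_nhdsWithin).exists
  have hρh : 0 < ρ * h := mul_pos hρ (one_pos.trans hh)
  have h2 : h ≤ H ρ (ρ * h) := by
    refine le_trans ?_ (hH.kinetic ρ (ρ * h) hρ hρh)
    rw [mul_div_cancel_left₀ _ hρ.ne']
    linarith [Real.sqrt_nonneg (1 + (ρ * h) ^ 2 / ρ ^ 2)]
  obtain ⟨p, hp, hpe⟩ := isPreconnected_Ioi.intermediate_value hp₁ hρh
    (fun p hp => (hH.hasDerivAt_pressure hρ hp).continuousAt.continuousWithinAt) ⟨h1.le, h2⟩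
  exact ⟨p, hp, hpe⟩

lemma pressure_spec (hH : CausalEOS H) (hP : IsPressureForm H P) (hρ : 0 < ρ) (hh : 1 < h) :
    0 < P ρ h ∧ H ρ (P ρ h) = h := by
  obtain ⟨p, hp, he⟩ := hH.exists_pressure hρ hh
  rw [← (hP ρ p h hρ hp).2 he.symm]
  exact ⟨hp, he⟩

/-- The kinetic-theory bound limits the pressure to half of `ρ h`. -/
lemma pressure_le (hH : CausalEOS H) (hP : IsPressureForm H P) (hρ : 0 < ρ) (hh : 1 < h) :
    P ρ h ≤ ρ * h / 2 := by
  obtain ⟨hp, he⟩ := hH.pressure_spec hP hρ hh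
  have h1 := hH.kinetic ρ _ hρ hp
  rw [he] at h1
  have h2 : P ρ h / ρ ≤ √(1 + P ρ h ^ 2 / ρ ^ 2) := by
    refine Real.le_sqrt_of_sq_le ?_
    rw [div_pow]; linarith
  have h3 : P ρ h / ρ ≤ h / 2 := by linarith
  rw [div_le_iff₀ hρ] at h3
  linarith

/-- Since only differentiability of `H` is available, continuity comes from the monotonicity of
`H` in the pressure instead of the implicit function theorem. -/
lemma continuousAt_pressure (hH : CausalEOS H) (hP : IsPressureForm H P) {r k : ℝ → ℝ} {x : ℝ}
    (hr : ContinuousAt r x) (hk : ContinuousAt k x) (hrx : 0 < r x) (hkx : 1 < k x) :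
    ContinuousAt (fun t => P (r t) (k t)) x := by
  obtain ⟨hp, he⟩ := hH.pressure_spec hP hrx hkx
  have hcont : ∀ q, 0 < q → ContinuousAt (fun t => H (r t) q) x := fun q hq =>
    (hH.hasDerivAt_density hrx hq).continuousAt.comp (f := r) hr
  refine tendsto_order.2 ⟨fun l hl => ?_, fun u hu => ?_⟩
  · -- The lower bound is raised to a positive one, where `H` is defined.
    obtain ⟨q, hq, hql⟩ := exists_between (max_lt hl hp)
    have hq0 : 0 < q := (le_max_right _ _).trans_lt hq
    have h1 : H (r x) q < k x := he ▸ hH.strictMonoOn_pressure hrx hq0 hp hql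
    filter_upwards [(hcont q hq0).eventually_lt hk h1, hr.eventually (lt_mem_nhds hrx),
      hk.eventually (lt_mem_nhds hkx)] with t ht htr htk
    obtain ⟨hpt, het⟩ := hH.pressure_spec hP htr htk
    rw [← het] at ht
    exact (le_max_left _ _).trans_lt
      (hq.trans (((hH.strictMonoOn_pressure htr).lt_iff_lt hq0 hpt).1 ht))
  · have hu0 : 0 < u := hp.trans hu
    have h1 : k x < H (r x) u := by
      have := hH.strictMonoOn_pressure hrx hp hu0 hu
      simpa only [he] using this
    filter_upwards [hk.eventually_lt (hcont u hu0) h1, hr.eventually (lt_mem_nhds hrx),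
      hk.eventually (lt_mem_nhds hkx)] with t ht htr htk
    obtain ⟨hpt, het⟩ := hH.pressure_spec hP htr htk
    rw [← het] at ht
    exact ((hH.strictMonoOn_pressure htr).lt_iff_lt hpt hu0).1 ht

/-- The chain rule for the pressure along a curve of states `(ρ, h)`, by inverting
`(ρ, p) ↦ (ρ, H ρ p)`. -/
lemma hasDerivAt_pressure_comp (hH : CausalEOS H) (hP : IsPressureForm H P) {r k : ℝ → ℝ}
    {x r' k' : ℝ} (hr : HasDerivAt r r' x) (hk : HasDerivAt k k' x) (hrx : 0 < r x)
    (hkx : 1 < k x) :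
    HasDerivAt (fun t => P (r t) (k t))
      ((k' - fderiv ℝ (fun q : ℝ × ℝ => H q.1 q.2) (r x, P (r x) (k x)) (1, 0) * r') /
        fderiv ℝ (fun q : ℝ × ℝ => H q.1 q.2) (r x, P (r x) (k x)) (0, 1)) x := by
  obtain ⟨hp, he⟩ := hH.pressure_spec hP hrx hkx
  have hc := hH.continuousAt_pressure hP hr.continuousAt hk.continuousAt hrx hkx
  have hLp := hH.fderiv_pressure_pos hrx hp
  have hL := (hH.differentiable _ _ hrx hp).hasFDerivAt
  set L := fderiv ℝ (fun q : ℝ × ℝ => H q.1 q.2) (r x, P (r x) (k x)) with hLdef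
  have hLapp : ∀ a c : ℝ, L (a, c) = L (1, 0) * a + L (0, 1) * c := fun a c => by
    have : ((a, c) : ℝ × ℝ) = a • (1, 0) + c • (0, 1) := by simp
    rw [this, map_add, map_smul, map_smul, smul_eq_mul, smul_eq_mul, mul_comm a, mul_comm c]
  let S : ℝ × ℝ →L[ℝ] ℝ × ℝ := (ContinuousLinearMap.fst ℝ ℝ ℝ).prod
    ((L (0, 1))⁻¹ • (ContinuousLinearMap.snd ℝ ℝ ℝ - L (1, 0) • ContinuousLinearMap.fst ℝ ℝ ℝ))
  have hS : Function.LeftInverse S ((ContinuousLinearMap.fst ℝ ℝ ℝ).prod L) := by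
    rintro ⟨a, c⟩
    refine Prod.ext rfl ?_
    simp only [S, ContinuousLinearMap.prod_apply, smul_apply,
      sub_apply, ContinuousLinearMap.coe_fst', ContinuousLinearMap.coe_snd',
      smul_eq_mul, hLapp a c]
    field_simp
    ring
  have hcomp : (fun q : ℝ × ℝ => (q.1, H q.1 q.2)) ∘ (fun t => (r t, P (r t) (k t)))
      =ᶠ[𝓝 x] fun t => (r t, k t) := by
    filter_upwards [hr.continuousAt.eventually (lt_mem_nhds hrx),
      hk.continuousAt.eventually (lt_mem_nhds hkx)] with t htr htk
    exact Prod.ext rfl (hH.pressure_spec hP htr htk).2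
  have := (HasFDerivAt.of_comp_of_leftInverse (hr.continuousAt.prodMk hc)
    (hasFDerivAt_fst.prodMk hL) (hr.prodMk hk).hasFDerivAt hcomp hS).snd.hasDerivAt
  convert! this using 1
  simp [S, div_eq_inv_mul]

end CausalEOS

lemma gammaLaw_causal {γ : ℝ} (h1 : 1 < γ) (h2 : γ ≤ 2) : CausalEOS (gammaLaw γ) := by
  have hγ : 0 < γ - 1 := sub_pos.2 h1
  have hdp : ∀ ρ p : ℝ, 0 < ρ →
      HasDerivAt (fun p' => gammaLaw γ ρ p') (γ / ((γ - 1) * ρ)) p := fun ρ p hρ => by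
    have := (((hasDerivAt_id p).const_mul γ).div_const ((γ - 1) * ρ)).const_add 1
    simpa [gammaLaw] using this
  have hdρ : ∀ ρ p : ℝ, 0 < ρ →
      HasDerivAt (fun ρ' => gammaLaw γ ρ' p) (-(γ * p / ((γ - 1) * ρ ^ 2))) ρ := fun ρ p hρ => by
    have := ((hasDerivAt_const ρ (γ * p)).div ((hasDerivAt_id ρ).const_mul (γ - 1))
      (mul_ne_zero hγ.ne' hρ.ne')).const_add 1
    convert! this using 1
    simp; field_simp
  refine ⟨fun ρ p hρ hp => ?_, fun ρ p hρ hp => ?_, fun ρ p hρ hp => ?_, fun ρ p hρ hp => ?_,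
    fun ρ hρ => ?_⟩
  · unfold gammaLaw
    have : (γ - 1) * (ρ, p).1 ≠ 0 := mul_ne_zero hγ.ne' hρ.ne'
    fun_prop (disch := assumption)
  · -- `√(1 + θ²) ≤ 1 + θ` and `γ / (γ - 1) ≥ 2`, where `θ = p / ρ`
    have hθ : 0 < p / ρ := div_pos hp hρ
    have e : gammaLaw γ ρ p = 1 + γ / (γ - 1) * (p / ρ) := by
      unfold gammaLaw; field_simp
    have h3 : 2 ≤ γ / (γ - 1) := by rw [le_div_iff₀ hγ]; linarith
    have h4 : √(1 + p ^ 2 / ρ ^ 2) ≤ 1 + p / ρ := by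
      rw [← div_pow]
      refine Real.sqrt_le_iff.2 ⟨by positivity, by nlinarith⟩
    rw [e]
    nlinarith
  · rw [(hdp ρ p hρ).deriv, (hdρ ρ p hρ).deriv]
    have e : gammaLaw γ ρ p * (1 / ρ - γ / ((γ - 1) * ρ)) - -(γ * p / ((γ - 1) * ρ ^ 2)) =
        -((1 + γ * (2 - γ) / (γ - 1) * (p / ρ)) / ((γ - 1) * ρ)) := by
      unfold gammaLaw; field_simp; ring
    have h3 : 0 ≤ γ * (2 - γ) / (γ - 1) :=
      div_nonneg (mul_nonneg (by linarith) (by linarith)) hγ.le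
    have h4 : 0 < (1 + γ * (2 - γ) / (γ - 1) * (p / ρ)) / ((γ - 1) * ρ) := by positivity
    linarith
  · rw [(hdρ ρ p hρ).deriv]
    have : 0 < γ := one_pos.trans h1
    exact neg_neg_of_pos (by positivity)
  · have := (hdp ρ 0 hρ).continuousAt.tendsto
    simp only [gammaLaw, mul_zero, zero_div, add_zero] at this
    exact this.mono_left nhdsWithin_le_nhds

lemma gammaLaw_twiceDifferentiable {γ : ℝ} (h1 : 1 < γ) :
    TwiceDifferentiableEOS (gammaLaw γ) := by
  have hγ : γ - 1 ≠ 0 := (sub_pos.2 h1).ne'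
  have hs : IsOpen (Ioi (0 : ℝ) ×ˢ Ioi (0 : ℝ)) := isOpen_Ioi.prod isOpen_Ioi
  have hc : ContDiffOn ℝ 2 (fun q : ℝ × ℝ => gammaLaw γ q.1 q.2) (Ioi 0 ×ˢ Ioi 0) := by
    unfold gammaLaw
    exact contDiffOn_const.add ((contDiffOn_const.mul contDiffOn_snd).div
      (contDiffOn_const.mul contDiffOn_fst) fun q hq => mul_ne_zero hγ hq.1.ne')
  exact ⟨hc.differentiableOn (by norm_num),
    (hc.fderiv_of_isOpen (m := 1) hs (by norm_num)).differentiableOn (by norm_num)⟩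

lemma gammaLaw_pressure_eq {γ : ℝ} (h1 : 1 < γ) {P : ℝ → ℝ → ℝ}
    (hP : IsPressureForm (gammaLaw γ) P) {ρ h : ℝ} (hρ : 0 < ρ) (hh : 1 < h) :
    P ρ h = (γ - 1) / γ * (ρ * h - ρ) := by
  have hγ : 0 < γ - 1 := sub_pos.2 h1
  have hγ0 : 0 < γ := one_pos.trans h1
  have e : (γ - 1) / γ * (ρ * h - ρ) = (γ - 1) / γ * ρ * (h - 1) := by ring
  rw [e]
  symm
  rw [hP ρ _ h hρ (mul_pos (by positivity) (sub_pos.2 hh))]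
  unfold gammaLaw; field_simp; ring

namespace ConsState

variable (U : ConsState)

/-! ### The Lorentz factor in terms of the momentum parallel and orthogonal to `B` -/

/-- The squared length of the component of `m` along `B`, which is `0` if `B = 0` (by the
convention `x / 0 = 0`). -/
noncomputable def parSq : ℝ := U.tau ^ 2 / ‖U.B‖ ^ 2

/-- The squared length of the component of `m` orthogonal to `B`. -/
noncomputable def perpSq : ℝ := ‖U.m‖ ^ 2 - U.parSq

/-- The quantity `1 - |v(ξ)|²`, which on `Ω₁` equals `1 / 𝒲(ξ)²`. -/
noncomputable def invWSq (ξ : ℝ) : ℝ :=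
  1 - U.perpSq / (ξ + ‖U.B‖ ^ 2) ^ 2 - U.parSq / ξ ^ 2

/-- Half of the derivative of `1 - |v(ξ)|²`. -/
noncomputable def halfSlope (ξ : ℝ) : ℝ :=
  U.perpSq / (ξ + ‖U.B‖ ^ 2) ^ 3 + U.parSq / ξ ^ 3

lemma parSq_nonneg : 0 ≤ U.parSq := by unfold parSq; positivity

lemma tau_sq_le : U.tau ^ 2 ≤ ‖U.m‖ ^ 2 * ‖U.B‖ ^ 2 := by
  rw [← mul_pow]
  exact sq_le_sq' (neg_le_of_abs_le (abs_real_inner_le_norm U.m U.B))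
    (real_inner_le_norm U.m U.B)

lemma parSq_mul : U.parSq * ‖U.B‖ ^ 2 = U.tau ^ 2 := by
  unfold parSq
  by_cases hB : ‖U.B‖ ^ 2 = 0
  · have h := U.tau_sq_le
    rw [hB, mul_zero] at h
    rw [hB, mul_zero, le_antisymm h (sq_nonneg _)]
  · exact div_mul_cancel₀ _ hB

lemma perpSq_nonneg : 0 ≤ U.perpSq :=
  sub_nonneg.2 (div_le_of_le_mul₀ (sq_nonneg _) (sq_nonneg _) U.tau_sq_le)

variable {U} {ξ : ℝ}

lemma add_normB_sq_pos (h0 : 0 < ξ) : 0 < ξ + ‖U.B‖ ^ 2 := by positivity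

lemma halfSlope_nonneg (h0 : 0 < ξ) : 0 ≤ U.halfSlope ξ := by
  have := U.parSq_nonneg
  have := U.perpSq_nonneg
  unfold halfSlope; positivity

lemma invWSq_mono {η : ℝ} (h0 : 0 < ξ) (h : ξ ≤ η) : U.invWSq ξ ≤ U.invWSq η := by
  have h1 : U.perpSq / (η + ‖U.B‖ ^ 2) ^ 2 ≤ U.perpSq / (ξ + ‖U.B‖ ^ 2) ^ 2 :=
    div_le_div_of_nonneg_left U.perpSq_nonneg (by positivity) (by gcongr)
  have h2 : U.parSq / η ^ 2 ≤ U.parSq / ξ ^ 2 :=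
    div_le_div_of_nonneg_left U.parSq_nonneg (by positivity) (by gcongr)
  unfold invWSq; linarith

lemma invWSq_le_one (h0 : 0 < ξ) : U.invWSq ξ ≤ 1 := by
  have h1 := U.perpSq_nonneg
  have h2 := U.parSq_nonneg
  have h3 : 0 ≤ U.perpSq / (ξ + ‖U.B‖ ^ 2) ^ 2 := by positivity
  have h4 : 0 ≤ U.parSq / ξ ^ 2 := by positivity
  unfold invWSq; linarith

lemma fa_eq (h0 : 0 < ξ) : U.fa ξ = ξ ^ 2 * (ξ + ‖U.B‖ ^ 2) ^ 2 * U.invWSq ξ := by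
  have hy := add_normB_sq_pos (U := U) h0
  unfold fa invWSq perpSq
  rw [← U.parSq_mul]
  field_simp
  ring

lemma fb_eq (h0 : 0 < ξ) :
    U.fb ξ = (ξ + ‖U.B‖ ^ 2) ^ 2 * (ξ ^ 2 * U.invWSq ξ - U.D ^ 2) := by
  unfold fb; rw [fa_eq h0]; ring

lemma fb_pos_iff (h0 : 0 < ξ) : 0 < U.fb ξ ↔ U.D ^ 2 < ξ ^ 2 * U.invWSq ξ := by
  have hy := add_normB_sq_pos (U := U) h0
  rw [fb_eq h0, mul_pos_iff_of_pos_left (by positivity), sub_pos]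

lemma mem_Omega1_iff (h0 : 0 < ξ) : ξ ∈ U.Omega1 ↔ 0 < U.invWSq ξ := by
  have hy := add_normB_sq_pos (U := U) h0
  simp only [Omega1, mem_ofPred_eq, h0, true_and]
  rw [fa_eq h0, mul_pos_iff_of_pos_left (by positivity)]

lemma invWSq_pos_of_fb_pos (h0 : 0 < ξ) (hb : 0 < U.fb ξ) : 0 < U.invWSq ξ := by
  rw [fb_pos_iff h0] at hb
  exact pos_of_mul_pos_right ((sq_nonneg _).trans_lt hb) (sq_nonneg _)

lemma W_eq (h0 : 0 < ξ) : U.W ξ = (√(U.invWSq ξ))⁻¹ := by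
  have hy := add_normB_sq_pos (U := U) h0
  unfold W
  rw [fa_eq h0, ← mul_pow, Real.sqrt_mul (sq_nonneg _), Real.sqrt_sq (by positivity)]
  field_simp

lemma dens_eq (h0 : 0 < ξ) : U.dens ξ = U.D * √(U.invWSq ξ) := by
  unfold dens; rw [W_eq h0, div_inv_eq_mul]

lemma enth_eq (h0 : 0 < ξ) : U.enth ξ = ξ * √(U.invWSq ξ) / U.D := by
  unfold enth; rw [W_eq h0, ← div_div, div_inv_eq_mul, div_mul_eq_mul_div]

lemma norm_vel_sq (h0 : 0 < ξ) : ‖U.vel ξ‖ ^ 2 = 1 - U.invWSq ξ := by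
  have hy := add_normB_sq_pos (U := U) h0
  unfold vel
  rw [norm_smul, mul_pow, norm_add_sq_real, inner_smul_right, norm_smul, mul_pow,
    Real.norm_eq_abs, Real.norm_eq_abs, sq_abs, sq_abs]
  change (ξ + ‖U.B‖ ^ 2)⁻¹ ^ 2 * (‖U.m‖ ^ 2 + 2 * (ξ⁻¹ * U.tau * U.tau) +
    (ξ⁻¹ * U.tau) ^ 2 * ‖U.B‖ ^ 2) = _
  have e : (ξ + ‖U.B‖ ^ 2)⁻¹ ^ 2 * (‖U.m‖ ^ 2 + 2 * (ξ⁻¹ * U.tau * U.tau) +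
    (ξ⁻¹ * U.tau) ^ 2 * ‖U.B‖ ^ 2) = (ξ + ‖U.B‖ ^ 2)⁻¹ ^ 2 * (‖U.m‖ ^ 2 +
      U.tau ^ 2 * (2 * ξ⁻¹ + ξ⁻¹ ^ 2 * ‖U.B‖ ^ 2)) := by ring
  rw [e, ← U.parSq_mul]
  unfold invWSq perpSq
  field_simp
  ring

lemma norm_vel_lt_one (h0 : 0 < ξ) (hu : 0 < U.invWSq ξ) : ‖U.vel ξ‖ < 1 := by
  have := norm_vel_sq (U := U) h0
  exact lt_of_pow_lt_pow_left₀ 2 zero_le_one (by rw [this]; linarith)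

lemma dens_pos (hD : 0 < U.D) (h0 : 0 < ξ) (hu : 0 < U.invWSq ξ) : 0 < U.dens ξ := by
  rw [dens_eq h0]
  exact mul_pos hD (Real.sqrt_pos.2 hu)

lemma one_lt_enth (hD : 0 < U.D) (h0 : 0 < ξ) (hb : 0 < U.fb ξ) : 1 < U.enth ξ := by
  have hu := invWSq_pos_of_fb_pos h0 hb
  rw [fb_pos_iff h0] at hb
  rw [enth_eq h0, one_lt_div hD]
  refine lt_of_pow_lt_pow_left₀ 2 (by positivity) ?_
  rwa [mul_pow, Real.sq_sqrt hu.le]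

lemma dens_mul_enth (hD : 0 < U.D) (h0 : 0 < ξ) (hu : 0 < U.invWSq ξ) :
    U.dens ξ * U.enth ξ = ξ * U.invWSq ξ := by
  rw [dens_eq h0, enth_eq h0]
  have := Real.mul_self_sqrt hu.le
  field_simp
  rw [pow_two, this]

lemma F_eq (P : ℝ → ℝ → ℝ) (h0 : 0 < ξ) (hu : 0 < U.invWSq ξ) :
    U.F P ξ = ξ - U.pres P ξ - (‖U.B‖ ^ 2 * U.invWSq ξ + U.tau ^ 2 / ξ ^ 2) / 2 +
      (‖U.B‖ ^ 2 - U.E) := by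
  unfold F
  rw [W_eq h0, inv_pow, Real.sq_sqrt hu.le, div_inv_eq_mul]

lemma hasDerivAt_invWSq (h0 : 0 < ξ) : HasDerivAt U.invWSq (2 * U.halfSlope ξ) ξ := by
  have hy := add_normB_sq_pos (U := U) h0
  have h1 := (hasDerivAt_const ξ U.perpSq).div
    (((hasDerivAt_id ξ).add_const (‖U.B‖ ^ 2)).pow 2) (by simp; positivity)
  have h2 := (hasDerivAt_const ξ U.parSq).div ((hasDerivAt_id ξ).pow 2) (by simp; positivity)
  convert! (h1.const_sub 1).sub h2 using 1
  unfold halfSlope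
  simp
  field_simp
  ring

lemma hasDerivAt_halfSlope (h0 : 0 < ξ) :
    HasDerivAt U.halfSlope
      (-3 * (U.perpSq / (ξ + ‖U.B‖ ^ 2) ^ 4 + U.parSq / ξ ^ 4)) ξ := by
  have hy := add_normB_sq_pos (U := U) h0
  have h1 := (hasDerivAt_const ξ U.perpSq).div
    (((hasDerivAt_id ξ).add_const (‖U.B‖ ^ 2)).pow 3) (by simp; positivity)
  have h2 := (hasDerivAt_const ξ U.parSq).div ((hasDerivAt_id ξ).pow 3) (by simp; positivity)
  convert! h1.add h2 using 1
  simp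
  field_simp
  ring

lemma hasDerivAt_sqrt_invWSq (h0 : 0 < ξ) (hu : 0 < U.invWSq ξ) :
    HasDerivAt (fun t => √(U.invWSq t)) (U.halfSlope ξ / √(U.invWSq ξ)) ξ := by
  convert (hasDerivAt_invWSq h0).sqrt hu.ne' using 1
  have := Real.sqrt_pos.2 hu
  field_simp

lemma continuous_fb : Continuous U.fb := by unfold fb fa; fun_prop

lemma fb_pos_of_lt {η : ℝ} (h0 : 0 < ξ) (hu : 0 < U.invWSq ξ) (hb : 0 ≤ U.fb ξ) (h : ξ < η) :
    0 < U.fb η := by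
  have hη := h0.trans h
  have hy := add_normB_sq_pos (U := U) h0
  rw [fb_eq h0, mul_nonneg_iff_of_pos_left (by positivity), sub_nonneg] at hb
  rw [fb_pos_iff hη]
  refine hb.trans_lt ?_
  calc ξ ^ 2 * U.invWSq ξ < η ^ 2 * U.invWSq ξ := by gcongr
    _ ≤ η ^ 2 * U.invWSq η := by gcongr; exact invWSq_mono h0 h.le

/-! ### The bracketing points -/

lemma E_pos (hU : U ∈ admissible) : 0 < U.E :=
  (Real.sqrt_nonneg _).trans_lt (sub_pos.1 hU.2.1)

lemma discr_pos (hU : U ∈ admissible) : 0 < U.E ^ 2 - U.D ^ 2 - ‖U.m‖ ^ 2 := by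
  have h := (Real.sqrt_lt' (E_pos hU)).1 (sub_pos.1 hU.2.1)
  linarith

lemma Phi_sq (hU : U ∈ admissible) : U.Phi ^ 2 =
    (‖U.B‖ ^ 2 - U.E) ^ 2 + 3 * (U.E ^ 2 - U.D ^ 2 - ‖U.m‖ ^ 2) := by
  have := discr_pos hU
  exact Real.sq_sqrt (by positivity)

lemma abs_lt_Phi (hU : U ∈ admissible) : |‖U.B‖ ^ 2 - U.E| < U.Phi := by
  have h := discr_pos hU
  refine lt_of_pow_lt_pow_left₀ 2 (Real.sqrt_nonneg _) ?_
  rw [Phi_sq hU, sq_abs]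
  linarith

/-- `ξ_d` is a root of the quadratic polynomial obtained by eliminating `Φ`. -/
lemma xid_quadratic (hU : U ∈ admissible) :
    (3 * U.xid - (U.E - ‖U.B‖ ^ 2)) * (U.xid - (U.E - ‖U.B‖ ^ 2)) =
      U.E ^ 2 - U.D ^ 2 - ‖U.m‖ ^ 2 := by
  have h := Phi_sq hU
  unfold xid
  linear_combination h / 3

lemma xid_pos (hU : U ∈ admissible) : 0 < U.xid := by
  have h1 : 0 < (U.Phi - 2 * (‖U.B‖ ^ 2 - U.E)) * √(U.Phi + ‖U.B‖ ^ 2 - U.E) :=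
    (Real.sqrt_nonneg _).trans_lt (sub_pos.1 hU.2.2)
  exact div_pos (pos_of_mul_pos_left h1 (Real.sqrt_nonneg _)) three_pos

/-- The condition `Ψ > 0` says that `f_c` is positive at `ξ_d`. -/
lemma fc_xid_pos (hU : U ∈ admissible) : 0 < U.fc U.xid := by
  have hd := xid_pos hU
  have h1 : 0 < U.Phi + ‖U.B‖ ^ 2 - U.E := by
    have := (abs_lt.1 (abs_lt_Phi hU)).1
    linarith
  have h2 : √(27 / 2 * (U.D ^ 2 * ‖U.B‖ ^ 2 + U.tau ^ 2)) <
      3 * U.xid * √(U.Phi + ‖U.B‖ ^ 2 - U.E) := by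
    have h := sub_pos.1 hU.2.2
    unfold xid
    convert! h using 2
    ring
  rw [Real.sqrt_lt' (by positivity), mul_pow, Real.sq_sqrt h1.le] at h2
  have h3 : U.Phi = 3 * U.xid + 2 * (‖U.B‖ ^ 2 - U.E) := by unfold xid; ring
  rw [h3] at h2
  unfold fc
  linarith

lemma fc_eq (ξ : ℝ) : U.fc ξ =
    ξ ^ 2 * (ξ - (U.E - ‖U.B‖ ^ 2)) - (‖U.B‖ ^ 2 * U.D ^ 2 + U.tau ^ 2) / 2 := by
  unfold fc; ring

lemma le_of_fc_nonneg (h0 : 0 < ξ) (hc : 0 ≤ U.fc ξ) : U.E - ‖U.B‖ ^ 2 ≤ ξ := by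
  rw [fc_eq] at hc
  have h : 0 ≤ ξ ^ 2 * (ξ - (U.E - ‖U.B‖ ^ 2)) := by
    have : 0 ≤ (‖U.B‖ ^ 2 * U.D ^ 2 + U.tau ^ 2) / 2 := by positivity
    linarith
  exact sub_nonneg.1 (nonneg_of_mul_nonneg_right h (by positivity))

lemma fc_lt_fc {η : ℝ} (h0 : 0 < ξ) (hc : 0 ≤ U.fc ξ) (h : ξ < η) : U.fc ξ < U.fc η := by
  have h1 := sub_nonneg.2 (le_of_fc_nonneg h0 hc)
  have hη := h0.trans h
  rw [fc_eq, fc_eq]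
  have : ξ ^ 2 * (ξ - (U.E - ‖U.B‖ ^ 2)) < η ^ 2 * (η - (U.E - ‖U.B‖ ^ 2)) :=
    calc ξ ^ 2 * (ξ - (U.E - ‖U.B‖ ^ 2)) ≤ η ^ 2 * (ξ - (U.E - ‖U.B‖ ^ 2)) := by gcongr
      _ < η ^ 2 * (η - (U.E - ‖U.B‖ ^ 2)) := by gcongr
  linarith

theorem exists_isUniqueRoot_fc (hU : U ∈ admissible) :
    ∃ ξc, IsUniqueRoot U.fc (Ioi 0) ξc ∧ ξc < U.xid := by
  have hd := xid_pos hU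
  have hfd := fc_xid_pos hU
  -- The search starts at the positive part of `E - B²`, where `f_c` is not positive.
  have hz : U.fc (max (U.E - ‖U.B‖ ^ 2) 0) ≤ 0 := by
    have : 0 ≤ (‖U.B‖ ^ 2 * U.D ^ 2 + U.tau ^ 2) / 2 := by positivity
    rw [fc_eq]
    rcases max_choice (U.E - ‖U.B‖ ^ 2) 0 with h | h <;> rw [h] <;> simp <;> linarith
  have hzd : max (U.E - ‖U.B‖ ^ 2) 0 ≤ U.xid := max_le (le_of_fc_nonneg hd hfd.le) hd.le
  have hcont : Continuous U.fc := by unfold fc; fun_prop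
  obtain ⟨c, hc, hfc⟩ := intermediate_value_Icc hzd hcont.continuousOn ⟨hz, hfd.le⟩
  have hc0 : 0 < c := by
    refine ((le_max_right _ _).trans hc.1).lt_of_ne fun h0 => ?_
    -- A root at `0` forces `B = 0`, and then the search starts at `E > 0`.
    have h1 : ‖U.B‖ ^ 2 * U.D ^ 2 + U.tau ^ 2 = 0 := by
      rw [← h0] at hfc; unfold fc at hfc; linarith
    have h2 : ‖U.B‖ ^ 2 = 0 := by
      have h3 : ‖U.B‖ ^ 2 * U.D ^ 2 = 0 := by
        nlinarith [sq_nonneg U.tau, mul_nonneg (sq_nonneg ‖U.B‖) (sq_nonneg U.D)]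
      exact (mul_eq_zero.1 h3).resolve_right (pow_ne_zero 2 hU.1.ne')
    have h3 := (le_max_left _ _).trans hc.1
    rw [h2, ← h0] at h3
    linarith [E_pos hU]
  refine ⟨c, ⟨⟨hc0, hfc⟩, fun y hy hfy => ?_⟩, hc.2.lt_of_ne ?_⟩
  · rcases lt_trichotomy y c with h | h | h
    · exact absurd (fc_lt_fc hy hfy.ge h) (by rw [hfc, hfy]; exact lt_irrefl _)
    · exact h
    · exact absurd (fc_lt_fc hc0 hfc.ge h) (by rw [hfc, hfy]; exact lt_irrefl _)
  · rintro rfl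
    exact hfd.ne' hfc

/-- At the root of `f_c`, the quadratic polynomial of `xid_quadratic` falls short of
`E² - D² - m²` by exactly `f_b / ξ²`, so `ξ_c < ξ_d` yields `f_b(ξ_c) > 0`. -/
lemma fb_pos_of_fc_eq_zero (hU : U ∈ admissible) (h0 : 0 < ξ) (hc : U.fc ξ = 0)
    (hd : ξ < U.xid) : 0 < U.fb ξ := by
  have hq := xid_quadratic hU
  have hle := le_of_fc_nonneg h0 hc.ge
  have hlt : (3 * ξ - (U.E - ‖U.B‖ ^ 2)) * (ξ - (U.E - ‖U.B‖ ^ 2)) <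
      U.E ^ 2 - U.D ^ 2 - ‖U.m‖ ^ 2 := by
    rw [← hq, ← sub_pos]
    have e : (3 * U.xid - (U.E - ‖U.B‖ ^ 2)) * (U.xid - (U.E - ‖U.B‖ ^ 2)) -
        (3 * ξ - (U.E - ‖U.B‖ ^ 2)) * (ξ - (U.E - ‖U.B‖ ^ 2)) =
        (U.xid - ξ) * (3 * (U.xid + ξ) - 4 * (U.E - ‖U.B‖ ^ 2)) := by ring
    rw [e]
    exact mul_pos (sub_pos.2 hd) (by linarith)
  have e : U.fb ξ = ξ ^ 2 * (U.E ^ 2 - U.D ^ 2 - ‖U.m‖ ^ 2 -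
      (3 * ξ - (U.E - ‖U.B‖ ^ 2)) * (ξ - (U.E - ‖U.B‖ ^ 2))) := by
    rw [fc_eq] at hc
    unfold fb fa
    linear_combination (2 * (2 * ξ + ‖U.B‖ ^ 2)) * hc
  rw [e]
  exact mul_pos (by positivity) (sub_pos.2 hlt)

theorem exists_isUniqueRoot_fb (hD : 0 < U.D) {ξc : ℝ} (hc0 : 0 < ξc) (hc : 0 < U.fb ξc) :
    ∃ ξb, IsUniqueRoot U.fb U.Omega1 ξb ∧ ξb < ξc := by
  have hneg : U.fb (U.D / 2) ≤ 0 := by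
    have h2 : 0 < U.D / 2 := half_pos hD
    by_contra! h
    rw [fb_pos_iff h2] at h
    nlinarith [invWSq_le_one (U := U) h2, mul_pos hD hD]
  obtain ⟨b, hb, hfb⟩ := isPreconnected_Ioi.intermediate_value (a := U.D / 2) (b := ξc)
    (half_pos hD) hc0 (continuous_fb (U := U)).continuousOn ⟨hneg, hc.le⟩
  have hb0 : 0 < b := hb
  have hbu : 0 < U.invWSq b := by
    have hy := add_normB_sq_pos (U := U) hb0
    have h := hfb
    rw [fb_eq hb0, mul_eq_zero, or_iff_right (by positivity)] at h
    have : 0 < b ^ 2 * U.invWSq b := by nlinarith [mul_pos hD hD]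
    exact pos_of_mul_pos_right this (sq_nonneg _)
  refine ⟨b, ⟨⟨(mem_Omega1_iff hb0).2 hbu, hfb⟩, fun y hy hfy => ?_⟩, ?_⟩
  · rcases lt_trichotomy y b with h | h | h
    · exact absurd hfb (fb_pos_of_lt hy.1 ((mem_Omega1_iff hy.1).1 hy) hfy.ge h).ne'
    · exact h
    · exact absurd hfy (fb_pos_of_lt hb0 hbu hfb.ge h).ne'
  · by_contra! h
    rcases h.eq_or_lt with rfl | h
    · exact hc.ne' hfb
    · exact (fb_pos_of_lt hc0 (invWSq_pos_of_fb_pos hc0 hc) hc.le h).ne' hfb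

/-! ### Monotonicity of the iterative function -/

section Causal

variable {H P : ℝ → ℝ → ℝ}

lemma pres_pos (hH : CausalEOS H) (hP : IsPressureForm H P) (hD : 0 < U.D) (h0 : 0 < ξ)
    (hb : 0 < U.fb ξ) : 0 < U.pres P ξ :=
  (hH.pressure_spec hP (dens_pos hD h0 (invWSq_pos_of_fb_pos h0 hb)) (one_lt_enth hD h0 hb)).1

/-- On the physical range, `f_c(ξ) / ξ²` is what `ℱ` becomes when the pressure is dropped and
`1 / 𝒲²` is replaced by its lower bound `D² / ξ²`. -/
lemma F_lt_fc_div (hH : CausalEOS H) (hP : IsPressureForm H P) (hD : 0 < U.D) (h0 : 0 < ξ)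
    (hb : 0 < U.fb ξ) : U.F P ξ < U.fc ξ / ξ ^ 2 := by
  have hu := invWSq_pos_of_fb_pos h0 hb
  have hp := pres_pos hH hP hD h0 hb
  rw [F_eq P h0 hu]
  rw [fb_pos_iff h0] at hb
  have h1 : U.D ^ 2 / ξ ^ 2 ≤ U.invWSq ξ := by
    rw [div_le_iff₀ (by positivity)]; linarith
  have h2 := mul_le_mul_of_nonneg_left h1 (sq_nonneg ‖U.B‖)
  have h3 : U.fc ξ / ξ ^ 2 =
      ξ - (‖U.B‖ ^ 2 * (U.D ^ 2 / ξ ^ 2) + U.tau ^ 2 / ξ ^ 2) / 2 + (‖U.B‖ ^ 2 - U.E) := by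
    unfold fc; field_simp; ring
  rw [h3]; linarith

lemma exists_F_pos (hH : CausalEOS H) (hP : IsPressureForm H P) (hD : 0 < U.D)
    (h0 : 0 < ξ) (hb : 0 < U.fb ξ) : ∃ η, ξ < η ∧ 0 < U.F P η := by
  obtain ⟨η, hη⟩ : ∃ η, max (max ξ 1) (‖U.B‖ ^ 2 + U.tau ^ 2 + 2 * (U.E - ‖U.B‖ ^ 2)) < η :=
    exists_gt _
  have h1 : ξ < η := (le_max_left _ _).trans_lt ((le_max_left _ _).trans_lt hη)
  have h2 : 1 < η := (le_max_right _ _).trans_lt ((le_max_left _ _).trans_lt hη)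
  have h3 := (le_max_right _ _).trans_lt hη
  have hη0 : 0 < η := h0.trans h1
  have hbη := fb_pos_of_lt h0 (invWSq_pos_of_fb_pos h0 hb) hb.le h1
  have hu := invWSq_pos_of_fb_pos hη0 hbη
  refine ⟨η, h1, ?_⟩
  have hp := hH.pressure_le hP (dens_pos hD hη0 hu) (one_lt_enth hD hη0 hbη)
  rw [dens_mul_enth hD hη0 hu] at hp
  have hu1 := invWSq_le_one (U := U) hη0
  have h4 : η * U.invWSq η ≤ η := mul_le_of_le_one_right hη0.le hu1
  have h5 : ‖U.B‖ ^ 2 * U.invWSq η ≤ ‖U.B‖ ^ 2 := mul_le_of_le_one_right (sq_nonneg _) hu1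
  have h6 : U.tau ^ 2 / η ^ 2 ≤ U.tau ^ 2 :=
    div_le_self (sq_nonneg _) (one_le_pow₀ h2.le)
  rw [F_eq P hη0 hu]
  change P (U.dens η) (U.enth η) ≤ _ at hp
  unfold pres
  linarith

lemma hasDerivAt_dens (h0 : 0 < ξ) (hu : 0 < U.invWSq ξ) :
    HasDerivAt U.dens (U.D * (U.halfSlope ξ / √(U.invWSq ξ))) ξ := by
  refine ((hasDerivAt_sqrt_invWSq h0 hu).const_mul U.D).congr_of_eventuallyEq ?_
  filter_upwards [lt_mem_nhds h0] with t ht using dens_eq ht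

lemma hasDerivAt_enth (h0 : 0 < ξ) (hu : 0 < U.invWSq ξ) :
    HasDerivAt U.enth
      ((√(U.invWSq ξ) + ξ * (U.halfSlope ξ / √(U.invWSq ξ))) / U.D) ξ := by
  have h := (((hasDerivAt_id ξ).mul (hasDerivAt_sqrt_invWSq h0 hu)).div_const U.D)
  simp only [one_mul, id] at h
  refine h.congr_of_eventuallyEq ?_
  filter_upwards [lt_mem_nhds h0] with t ht using enth_eq ht

/-- The derivative of `p(ξ)` in terms of the partial derivatives of the equation of state. -/
noncomputable def presSlope (U : ConsState) (H P : ℝ → ℝ → ℝ) (ξ : ℝ) : ℝ :=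
  ((√(U.invWSq ξ) + ξ * (U.halfSlope ξ / √(U.invWSq ξ))) / U.D -
    fderiv ℝ (fun q : ℝ × ℝ => H q.1 q.2) (U.dens ξ, U.pres P ξ) (1, 0) *
      (U.D * (U.halfSlope ξ / √(U.invWSq ξ)))) /
    fderiv ℝ (fun q : ℝ × ℝ => H q.1 q.2) (U.dens ξ, U.pres P ξ) (0, 1)

lemma hasDerivAt_pres (hH : CausalEOS H) (hP : IsPressureForm H P) (hD : 0 < U.D)
    (h0 : 0 < ξ) (hb : 0 < U.fb ξ) : HasDerivAt (U.pres P) (U.presSlope H P ξ) ξ :=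
  have hu := invWSq_pos_of_fb_pos h0 hb
  hH.hasDerivAt_pressure_comp hP (hasDerivAt_dens h0 hu) (hasDerivAt_enth h0 hu)
    (dens_pos hD h0 hu) (one_lt_enth hD h0 hb)

/-- Differentiation of `ℱ`, for any pressure that is differentiable in `ξ`. -/
lemma hasDerivAt_F {p' : ℝ} (h0 : 0 < ξ) (hu : 0 < U.invWSq ξ)
    (hp : HasDerivAt (U.pres P) p' ξ) :
    HasDerivAt (U.F P) (1 - p' - ‖U.B‖ ^ 2 * U.halfSlope ξ + U.tau ^ 2 / ξ ^ 3) ξ := by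
  have h1 := (hasDerivAt_invWSq (U := U) h0).const_mul (‖U.B‖ ^ 2)
  have h2 := (hasDerivAt_const ξ (U.tau ^ 2)).div ((hasDerivAt_id ξ).pow 2)
    (by simp; positivity)
  have h3 := (((hasDerivAt_id ξ).sub hp).sub ((h1.add h2).div_const 2)).add_const
    (‖U.B‖ ^ 2 - U.E)
  have hev : U.F P =ᶠ[𝓝 ξ] fun t => t - U.pres P t -
      (‖U.B‖ ^ 2 * U.invWSq t + U.tau ^ 2 / t ^ 2) / 2 + (‖U.B‖ ^ 2 - U.E) := by
    filter_upwards [lt_mem_nhds h0,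
      (hasDerivAt_invWSq h0).continuousAt.eventually (lt_mem_nhds hu)] with t ht htu
    exact F_eq P ht htu
  refine HasDerivAt.congr_of_eventuallyEq ?_ hev
  convert! h3 using 1
  simp
  field_simp
  ring

/-- The causality condition bounds the slope of the pressure by
`1 / 𝒲² + ξ (1 / 𝒲²)' / 2`. -/
lemma presSlope_lt (hH : CausalEOS H) (hP : IsPressureForm H P) (hD : 0 < U.D)
    (h0 : 0 < ξ) (hb : 0 < U.fb ξ) :
    U.presSlope H P ξ < U.invWSq ξ + ξ * U.halfSlope ξ := by
  have hu := invWSq_pos_of_fb_pos h0 hb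
  have hρ := dens_pos hD h0 hu
  obtain ⟨hp, he⟩ := hH.pressure_spec hP hρ (one_lt_enth hD h0 hb)
  change H (U.dens ξ) (U.pres P ξ) = U.enth ξ at he
  have hp' : 0 < U.pres P ξ := hp
  have h1 := hH.inv_lt_fderiv_pressure hρ hp'
  have h2 := hH.mul_lt_fderiv_density hρ hp'
  have h3 := hH.fderiv_pressure_pos hρ hp'
  unfold presSlope
  set L := fderiv ℝ (fun q : ℝ × ℝ => H q.1 q.2) (U.dens ξ, U.pres P ξ)
  rw [he] at h2
  rw [dens_eq h0] at h1 h2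
  rw [enth_eq h0] at h2
  have hs := Real.sqrt_pos.2 hu
  have hss := Real.mul_self_sqrt hu.le
  set s := √(U.invWSq ξ)
  have hg := halfSlope_nonneg (U := U) h0
  set g := U.halfSlope ξ
  rw [div_lt_iff₀ h3, ← hss]
  have hk : 0 ≤ U.D * (g / s) := by positivity
  have h4 := mul_le_mul_of_nonneg_right h2.le hk
  have h5 : s / U.D < s * s * L (0, 1) := by
    calc s / U.D = s * s * (1 / (U.D * s)) := by field_simp
      _ < s * s * L (0, 1) := by gcongr
  have e : ξ * s / U.D * (1 / (U.D * s) - L (0, 1)) * (U.D * (g / s)) =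
      ξ * (g / s) / U.D - ξ * g * L (0, 1) := by field_simp
  rw [e] at h4
  rw [add_div, add_mul]
  linarith

/-- The bound on the slope of the pressure is exactly complementary to the magnetic terms. -/
lemma one_sub_slope_eq_zero (h0 : 0 < ξ) :
    1 - (U.invWSq ξ + ξ * U.halfSlope ξ) - ‖U.B‖ ^ 2 * U.halfSlope ξ + U.tau ^ 2 / ξ ^ 3 = 0 := by
  have hy := add_normB_sq_pos (U := U) h0
  rw [← U.parSq_mul]
  unfold invWSq halfSlope
  field_simp
  ring

lemma hasDerivAt_F_of_causal (hH : CausalEOS H) (hP : IsPressureForm H P) (hD : 0 < U.D)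
    (h0 : 0 < ξ) (hb : 0 < U.fb ξ) :
    HasDerivAt (U.F P)
      (1 - U.presSlope H P ξ - ‖U.B‖ ^ 2 * U.halfSlope ξ + U.tau ^ 2 / ξ ^ 3) ξ :=
  hasDerivAt_F h0 (invWSq_pos_of_fb_pos h0 hb) (hasDerivAt_pres hH hP hD h0 hb)

theorem deriv_F_pos (hH : CausalEOS H) (hP : IsPressureForm H P) (hD : 0 < U.D)
    (h0 : 0 < ξ) (hb : 0 < U.fb ξ) : 0 < deriv (U.F P) ξ := by
  rw [(hasDerivAt_F_of_causal hH hP hD h0 hb).deriv]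
  linarith [presSlope_lt hH hP hD h0 hb, one_sub_slope_eq_zero (U := U) h0]

lemma differentiableAt_deriv_F (hH : CausalEOS H) (hP : IsPressureForm H P) (hD : 0 < U.D)
    (h2 : TwiceDifferentiableEOS H) (h0 : 0 < ξ) (hb : 0 < U.fb ξ) :
    DifferentiableAt ℝ (deriv (U.F P)) ξ := by
  have hu := invWSq_pos_of_fb_pos h0 hb
  have hρ := dens_pos hD h0 hu
  have hp := pres_pos hH hP hD h0 hb
  have hev : deriv (U.F P) =ᶠ[𝓝 ξ] fun t =>
      1 - U.presSlope H P t - ‖U.B‖ ^ 2 * U.halfSlope t + U.tau ^ 2 / t ^ 3 := by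
    filter_upwards [lt_mem_nhds h0,
      (continuous_fb (U := U)).continuousAt.eventually (lt_mem_nhds hb)] with t ht htb
    exact (hasDerivAt_F_of_causal hH hP hD ht htb).deriv
  refine DifferentiableAt.congr_of_eventuallyEq ?_ hev
  have hdens := (hasDerivAt_dens h0 hu).differentiableAt
  have hpres := (hasDerivAt_pres hH hP hD h0 hb).differentiableAt
  have hsqrt := (hasDerivAt_sqrt_invWSq h0 hu).differentiableAt
  have hhalf := (hasDerivAt_halfSlope (U := U) h0).differentiableAt
  have hs : √(U.invWSq ξ) ≠ 0 := (Real.sqrt_pos.2 hu).ne'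
  have hL : DifferentiableAt ℝ (fun t =>
      fderiv ℝ (fun q : ℝ × ℝ => H q.1 q.2) (U.dens t, U.pres P t)) ξ :=
    DifferentiableAt.comp (f := fun t => (U.dens t, U.pres P t)) ξ
      (h2.2.differentiableAt ((isOpen_Ioi.prod isOpen_Ioi).mem_nhds ⟨hρ, hp⟩))
      (hdens.prodMk hpres)
  have hL0 := hL.clm_apply (differentiableAt_const ((1, 0) : ℝ × ℝ))
  have hL1 := hL.clm_apply (differentiableAt_const ((0, 1) : ℝ × ℝ))
  have hne := (hH.fderiv_pressure_pos hρ hp).ne'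
  have hquot := hhalf.div hsqrt hs
  have hps : DifferentiableAt ℝ (U.presSlope H P) ξ :=
    (((hsqrt.add (differentiableAt_id.mul hquot)).div_const U.D).sub
      (hL0.mul (hquot.const_mul U.D))).div hL1 hne
  exact (((differentiableAt_const 1).sub hps).sub (hhalf.const_mul _)).add
    ((differentiableAt_const _).div (differentiableAt_id.pow 3) (by simp; positivity))

end Causal

end ConsState

/-! ### The shape of the iterative function for the `γ`-law -/

/-- A second derivative that never turns negative again gives at most one inflection point. -/
lemma derivMonotoneOrOneInflection_of_sign {f f₂ : ℝ → ℝ} {a : ℝ}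
    (hd : ∀ x, a < x → HasDerivAt (deriv f) (f₂ x) x)
    (hsign : ∀ x y, a < x → x < y → 0 ≤ f₂ x → 0 ≤ f₂ y) :
    DerivMonotoneOrOneInflection f a := by
  have hmono : ∀ D : Set ℝ, Convex ℝ D → D ⊆ Ioi a → (∀ x ∈ interior D, 0 ≤ f₂ x) →
      MonotoneOn (deriv f) D := fun D hD hsub h =>
    monotoneOn_of_deriv_nonneg hD
      (fun x hx => (hd x (hsub hx)).continuousAt.continuousWithinAt)
      (fun x hx => (hd x (hsub (interior_subset hx))).differentiableAt.differentiableWithinAt)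
      fun x hx => by rw [(hd x (hsub (interior_subset hx))).deriv]; exact h x hx
  have hanti : ∀ D : Set ℝ, Convex ℝ D → D ⊆ Ioi a → (∀ x ∈ interior D, f₂ x ≤ 0) →
      AntitoneOn (deriv f) D := fun D hD hsub h =>
    antitoneOn_of_deriv_nonpos hD
      (fun x hx => (hd x (hsub hx)).continuousAt.continuousWithinAt)
      (fun x hx => (hd x (hsub (interior_subset hx))).differentiableAt.differentiableWithinAt)
      fun x hx => by rw [(hd x (hsub (interior_subset hx))).deriv]; exact h x hx
  by_cases hS : ∃ x, a < x ∧ 0 ≤ f₂ x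
  · obtain ⟨x₀, hx₀⟩ := hS
    set S := {x | a < x ∧ 0 ≤ f₂ x} with hSdef
    have hne : S.Nonempty := ⟨x₀, hx₀⟩
    have hbdd : BddBelow S := ⟨a, fun x hx => hx.1.le⟩
    have hright : ∀ x, sInf S < x → 0 ≤ f₂ x := fun x hx => by
      obtain ⟨z, hz, hzx⟩ := (csInf_lt_iff hbdd hne).1 hx
      exact hsign z x hz.1 hzx hz.2
    rcases (le_csInf hne fun x hx => hx.1.le : a ≤ sInf S).eq_or_lt with h | h
    · refine Or.inl (hmono _ (convex_Ioi a) subset_rfl fun x hx => hright x ?_)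
      rw [interior_Ioi] at hx
      rwa [← h]
    · refine Or.inr (Or.inr ⟨sInf S, h, hanti _ (convex_Ioc _ _) (fun x hx => hx.1) ?_,
        hmono _ (convex_Ici _) (fun x hx => h.trans_le hx) ?_⟩)
      · intro x hx
        rw [interior_Ioc] at hx
        by_contra! hpos
        exact not_le.2 hx.2 (csInf_le hbdd ⟨hx.1, hpos.le⟩)
      · intro x hx
        rw [interior_Ici] at hx
        exact hright x hx
  · push Not at hS
    refine Or.inr (Or.inl (hanti _ (convex_Ioi a) subset_rfl fun x hx => ?_))
    rw [interior_Ioi] at hx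
    exact (hS x hx).le

namespace ConsState

variable {U : ConsState} {ξ γ : ℝ} {P : ℝ → ℝ → ℝ}

lemma hasDerivAt_pres_gammaLaw (h1 : 1 < γ) (hP : IsPressureForm (gammaLaw γ) P)
    (hD : 0 < U.D) (h0 : 0 < ξ) (hb : 0 < U.fb ξ) :
    HasDerivAt (U.pres P) ((γ - 1) / γ * (U.invWSq ξ + 2 * ξ * U.halfSlope ξ -
      U.D * (U.halfSlope ξ / √(U.invWSq ξ)))) ξ := by
  have hu := invWSq_pos_of_fb_pos h0 hb
  have h := ((((hasDerivAt_id ξ).mul (hasDerivAt_invWSq (U := U) h0)).sub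
    ((hasDerivAt_sqrt_invWSq h0 hu).const_mul U.D)).const_mul ((γ - 1) / γ))
  have hev : U.pres P =ᶠ[𝓝 ξ] fun t =>
      (γ - 1) / γ * (t * U.invWSq t - U.D * √(U.invWSq t)) := by
    filter_upwards [lt_mem_nhds h0,
      (continuous_fb (U := U)).continuousAt.eventually (lt_mem_nhds hb)] with t ht htb
    have htu := invWSq_pos_of_fb_pos ht htb
    unfold pres
    rw [gammaLaw_pressure_eq h1 hP (dens_pos hD ht htu) (one_lt_enth hD ht htb),
      dens_mul_enth hD ht htu, dens_eq ht]
  refine HasDerivAt.congr_of_eventuallyEq ?_ hev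
  convert! h using 1
  simp only [id, one_mul]
  ring

/-- The second derivative of `ℱ` for the `γ`-law, as a difference of two terms that are nonnegative
if `γ ≤ 2`. Only the second one involves the Lorentz factor. -/
lemma hasDerivAt_deriv_F_gammaLaw (h1 : 1 < γ) (hP : IsPressureForm (gammaLaw γ) P)
    (hD : 0 < U.D) (h0 : 0 < ξ) (hb : 0 < U.fb ξ) :
    HasDerivAt (deriv (U.F P))
      (2 * ((γ - 1) / γ) * U.halfSlope ξ +
        (3 - 6 * ((γ - 1) / γ)) * ‖U.B‖ ^ 2 * (U.perpSq / (ξ + ‖U.B‖ ^ 2) ^ 4) -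
        (γ - 1) / γ * U.D *
          (3 * (U.perpSq / (ξ + ‖U.B‖ ^ 2) ^ 4 + U.parSq / ξ ^ 4) / √(U.invWSq ξ) +
            U.halfSlope ξ ^ 2 / √(U.invWSq ξ) ^ 3)) ξ := by
  have hu := invWSq_pos_of_fb_pos h0 hb
  have hy := add_normB_sq_pos (U := U) h0
  have hs := Real.sqrt_pos.2 hu
  have hg := hasDerivAt_halfSlope (U := U) h0
  have hev : deriv (U.F P) =ᶠ[𝓝 ξ] fun t =>
      1 - (γ - 1) / γ * (U.invWSq t + 2 * t * U.halfSlope t -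
        U.D * (U.halfSlope t / √(U.invWSq t))) - ‖U.B‖ ^ 2 * U.halfSlope t +
        U.tau ^ 2 / t ^ 3 := by
    filter_upwards [lt_mem_nhds h0,
      (continuous_fb (U := U)).continuousAt.eventually (lt_mem_nhds hb)] with t ht htb
    exact (hasDerivAt_F ht (invWSq_pos_of_fb_pos ht htb)
      (hasDerivAt_pres_gammaLaw h1 hP hD ht htb)).deriv
  have h2 := (((hasDerivAt_invWSq (U := U) h0).add (((hasDerivAt_id ξ).const_mul 2).mul hg)).sub
    ((hg.div (hasDerivAt_sqrt_invWSq h0 hu) hs.ne').const_mul U.D)).const_mul ((γ - 1) / γ)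
  have h3 : HasDerivAt (fun t => U.tau ^ 2 / t ^ 3) (-3 * (U.tau ^ 2 / ξ ^ 4)) ξ := by
    have h := (hasDerivAt_const ξ (U.tau ^ 2)).div ((hasDerivAt_id ξ).pow 3)
      (by simp; positivity)
    convert! h using 1
    simp
    field_simp
  have h4 := ((h2.const_sub 1).sub (hg.const_mul (‖U.B‖ ^ 2))).add h3
  refine HasDerivAt.congr_of_eventuallyEq ?_ hev
  convert! h4 using 1
  simp only [id, mul_one]
  rw [← U.parSq_mul]
  generalize (γ - 1) / γ = κ
  generalize √(U.invWSq ξ) = s at hs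
  unfold halfSlope
  field_simp
  ring

end ConsState

/-- Monotonicity of three ratios of inverse powers of `x` and `x + b`, written with the
denominators cleared. The first one holds because, with `r = 1 + b / x`, the ratio of
`A / (x + b)³ + C / x³` to `A / (x + b)⁴ + C / x⁴` is `x + b A / (A + C r⁴)`, where `r` decreases
in `x`. -/
lemma inverse_powers_cross_le {A C b x y : ℝ} (hA : 0 ≤ A) (hC : 0 ≤ C) (hb : 0 ≤ b)
    (hx : 0 < x) (hxy : x < y) :
    (A / (y + b) ^ 4 + C / y ^ 4) * (A / (x + b) ^ 3 + C / x ^ 3) ≤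
        (A / (x + b) ^ 4 + C / x ^ 4) * (A / (y + b) ^ 3 + C / y ^ 3) ∧
      (A / (y + b) ^ 4 + C / y ^ 4) * (1 / (x + b) ^ 4) ≤
        (A / (x + b) ^ 4 + C / x ^ 4) * (1 / (y + b) ^ 4) ∧
      (A / (y + b) ^ 3 + C / y ^ 3) ^ 2 * (1 / (x + b) ^ 4) ≤
        (A / (x + b) ^ 3 + C / x ^ 3) ^ 2 * (1 / (y + b) ^ 4) := by
  have hy := hx.trans hxy
  have hxb : 0 < x + b := by positivity
  have hyb : 0 < y + b := by positivity
  have hr : (y + b) / y ≤ (x + b) / x := by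
    rw [div_le_div_iff₀ hy hx]; nlinarith
  have hr2 : ((y + b) / y) ^ 2 ≤ ((x + b) / x) ^ 2 := by gcongr
  have hr4 : ((y + b) / y) ^ 4 ≤ ((x + b) / x) ^ 4 := by gcongr
  have q_eq : ∀ t, 0 < t → A / (t + b) ^ 4 + C / t ^ 4 =
      (A + C * ((t + b) / t) ^ 4) / (t + b) ^ 4 := fun t ht => by
    have : 0 < t + b := by positivity
    field_simp
  have g_eq : ∀ t, 0 < t → A / (t + b) ^ 3 + C / t ^ 3 =
      (A * (t + b) + C * ((t + b) / t) ^ 4 * t) / (t + b) ^ 4 := fun t ht => by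
    have : 0 < t + b := by positivity
    field_simp
  refine ⟨?_, ?_, ?_⟩
  · rw [q_eq y hy, q_eq x hx, g_eq y hy, g_eq x hx, div_mul_div_comm, div_mul_div_comm,
      mul_comm ((y + b) ^ 4)]
    refine div_le_div_of_nonneg_right ?_ (by positivity)
    have hR : 0 ≤ ((y + b) / y) ^ 4 := by positivity
    have hS : 0 ≤ ((x + b) / x) ^ 4 := by positivity
    generalize ((y + b) / y) ^ 4 = R at *
    generalize ((x + b) / x) ^ 4 = S at *
    have e : (A + C * S) * (A * (y + b) + C * R * y) -
        (A + C * R) * (A * (x + b) + C * S * x) =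
        A ^ 2 * (y - x) + A * C * ((S - R) * b + (S + R) * (y - x)) +
          C ^ 2 * (S * R) * (y - x) := by ring
    have h1 := sub_nonneg.2 hxy.le
    have h2 := sub_nonneg.2 hr4
    rw [← sub_nonneg, e]
    positivity
  · rw [q_eq y hy, q_eq x hx, div_mul_div_comm, div_mul_div_comm, mul_comm ((y + b) ^ 4)]
    refine div_le_div_of_nonneg_right ?_ (by positivity)
    gcongr
  · have h_eq : ∀ t, 0 < t → (A / (t + b) ^ 3 + C / t ^ 3) ^ 2 =
        (A / (t + b) + C * ((t + b) / t) ^ 2 / t) ^ 2 / (t + b) ^ 4 := fun t ht => by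
      have : 0 < t + b := by positivity
      field_simp
    rw [h_eq y hy, h_eq x hx, div_mul_div_comm, div_mul_div_comm, mul_comm ((y + b) ^ 4)]
    refine div_le_div_of_nonneg_right ?_ (by positivity)
    gcongr

/-- If both ratios `q / G` and `g² / G` decrease and `s` increases, then `G` stays above
`c (3 q / s + g² / s³)` once it has reached it. -/
lemma sub_nonneg_of_cross_le {c q₁ q₂ g₁ g₂ G₁ G₂ s₁ s₂ : ℝ} (hc : 0 ≤ c) (hq : 0 ≤ q₂)
    (hG₁ : 0 < G₁) (hG₂ : 0 ≤ G₂) (hs₁ : 0 < s₁) (hs : s₁ ≤ s₂) (hqG : q₂ * G₁ ≤ q₁ * G₂)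
    (hgG : g₂ ^ 2 * G₁ ≤ g₁ ^ 2 * G₂)
    (h : 0 ≤ G₁ - c * (3 * q₁ / s₁ + g₁ ^ 2 / s₁ ^ 3)) :
    0 ≤ G₂ - c * (3 * q₂ / s₂ + g₂ ^ 2 / s₂ ^ 3) := by
  have h1 : 3 * q₂ / s₂ + g₂ ^ 2 / s₂ ^ 3 ≤ 3 * q₂ / s₁ + g₂ ^ 2 / s₁ ^ 3 := by gcongr
  have h2 : (3 * q₂ / s₁ + g₂ ^ 2 / s₁ ^ 3) * G₁ ≤ (3 * q₁ / s₁ + g₁ ^ 2 / s₁ ^ 3) * G₂ := by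
    have e1 : (3 * q₂ / s₁ + g₂ ^ 2 / s₁ ^ 3) * G₁ =
        3 * (q₂ * G₁) / s₁ + g₂ ^ 2 * G₁ / s₁ ^ 3 := by ring
    have e2 : (3 * q₁ / s₁ + g₁ ^ 2 / s₁ ^ 3) * G₂ =
        3 * (q₁ * G₂) / s₁ + g₁ ^ 2 * G₂ / s₁ ^ 3 := by ring
    rw [e1, e2]
    gcongr
  rw [sub_nonneg] at h ⊢
  refine le_of_mul_le_mul_right ?_ hG₁
  calc c * (3 * q₂ / s₂ + g₂ ^ 2 / s₂ ^ 3) * G₁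
      ≤ c * (3 * q₂ / s₁ + g₂ ^ 2 / s₁ ^ 3) * G₁ := by gcongr
    _ = c * ((3 * q₂ / s₁ + g₂ ^ 2 / s₁ ^ 3) * G₁) := mul_assoc _ _ _
    _ ≤ c * ((3 * q₁ / s₁ + g₁ ^ 2 / s₁ ^ 3) * G₂) := by gcongr
    _ = c * (3 * q₁ / s₁ + g₁ ^ 2 / s₁ ^ 3) * G₂ := (mul_assoc _ _ _).symm
    _ ≤ G₁ * G₂ := by gcongr
    _ = G₂ * G₁ := mul_comm _ _

namespace ConsState

variable {U : ConsState} {γ : ℝ} {P : ℝ → ℝ → ℝ}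

theorem derivMonotoneOrOneInflection_F_gammaLaw (h1 : 1 < γ) (h2 : γ ≤ 2)
    (hP : IsPressureForm (gammaLaw γ) P) (hD : 0 < U.D) {ξb : ℝ} (hb0 : 0 ≤ ξb)
    (hfb : ∀ ξ, ξb < ξ → 0 < U.fb ξ) : DerivMonotoneOrOneInflection (U.F P) ξb := by
  have hγ : 0 < γ := one_pos.trans h1
  have hκ : 0 < (γ - 1) / γ := div_pos (sub_pos.2 h1) hγ
  have hκ2 : (γ - 1) / γ ≤ 1 / 2 := by rw [div_le_div_iff₀ hγ two_pos]; linarith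
  refine derivMonotoneOrOneInflection_of_sign (fun ξ hξ =>
    hasDerivAt_deriv_F_gammaLaw h1 hP hD (hb0.trans_lt hξ) (hfb ξ hξ)) fun x y hx hxy h => ?_
  have hx0 := hb0.trans_lt hx
  have hy0 := hx0.trans hxy
  have hA := U.perpSq_nonneg
  have hC := U.parSq_nonneg
  have hxb := add_normB_sq_pos (U := U) hx0
  have hyb := add_normB_sq_pos (U := U) hy0
  have hux := invWSq_pos_of_fb_pos hx0 (hfb x hx)
  have hgx := halfSlope_nonneg (U := U) hx0
  have hgy := halfSlope_nonneg (U := U) hy0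
  have hlam : 0 ≤ (3 - 6 * ((γ - 1) / γ)) * ‖U.B‖ ^ 2 :=
    mul_nonneg (by linarith) (sq_nonneg _)
  obtain ⟨hc1, hc2, hc3⟩ := inverse_powers_cross_le hA hC (sq_nonneg ‖U.B‖) hx0 hxy
  have hgle : U.halfSlope y ≤ U.halfSlope x := by unfold halfSlope; gcongr
  change _ * U.halfSlope x ≤ _ * U.halfSlope y at hc1
  change U.halfSlope y ^ 2 * _ ≤ U.halfSlope x ^ 2 * _ at hc3
  rcases hgx.eq_or_lt with h0 | h0
  · -- If `m = 0`, then `ℱ` is affine.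
    have hA0 : U.perpSq = 0 ∧ U.parSq = 0 := by
      have e1 : 0 ≤ U.perpSq / (x + ‖U.B‖ ^ 2) ^ 3 := by positivity
      have e2 : 0 ≤ U.parSq / x ^ 3 := by positivity
      have e3 := h0
      unfold halfSlope at e3
      have e4 := (add_eq_zero_iff_of_nonneg e1 e2).1 e3.symm
      refine ⟨?_, ?_⟩
      · exact (div_eq_zero_iff.1 e4.1).resolve_right (by positivity)
      · exact (div_eq_zero_iff.1 e4.2).resolve_right (by positivity)
    unfold halfSlope
    simp [hA0.1, hA0.2]
  refine sub_nonneg_of_cross_le (mul_nonneg hκ.le hD.le) (by positivity) (by positivity)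
    (by positivity) (Real.sqrt_pos.2 hux) (Real.sqrt_le_sqrt (invWSq_mono hx0 hxy.le)) ?_ ?_ h
  · have e := mul_le_mul_of_nonneg_left hc1 (mul_nonneg zero_le_two hκ.le)
    have e' := mul_le_mul_of_nonneg_left hc2 (mul_nonneg hlam hA)
    linear_combination e + e'
  · have e : U.halfSlope y ^ 2 * U.halfSlope x ≤ U.halfSlope x ^ 2 * U.halfSlope y := by
      have := mul_le_mul_of_nonneg_left hgle (mul_nonneg hgy hgx)
      linarith
    have e1 := mul_le_mul_of_nonneg_left e (mul_nonneg zero_le_two hκ.le)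
    have e2 := mul_le_mul_of_nonneg_left hc3 (mul_nonneg hlam hA)
    linear_combination e1 + e2

/-! ### Convergence for admissible states -/

variable {H : ℝ → ℝ → ℝ}

/-- The behaviour of the two Newton sequences for a causal equation of state. -/
theorem newton_F_converges (hH : CausalEOS H) (hP : IsPressureForm H P) (hD : 0 < U.D)
    {ξb ξc : ℝ} (hb : IsUniqueRoot U.fb U.Omega1 ξb) (hc : IsUniqueRoot U.fc (Ioi 0) ξc)
    (hbc : ξb < ξc) (hcd : ξc < U.xid) (hshape : DerivMonotoneOrOneInflection (U.F P) ξb) :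
    ∃ ξs : ℝ, IsUniqueRoot (U.F P) (Ioi ξb) ξs ∧
      ∀ ξ₀ : ℝ, (ξ₀ = U.hybrid P ξc ∨ ξ₀ = ξc) →
        NewtonWellDefined (U.F P) (newton (U.F P) ξ₀) ∧
        U.PCP P (newton (U.F P) ξ₀) ∧
        Tendsto (newton (U.F P) ξ₀) atTop (𝓝 ξs) ∧
        (TwiceDifferentiableEOS H → QuadraticRate (newton (U.F P) ξ₀) ξs) := by
  have hb0 : 0 < ξb := hb.1.1.1
  have hfb : ∀ ξ, ξb < ξ → 0 < U.fb ξ := fun ξ hξ =>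
    fb_pos_of_lt hb0 ((mem_Omega1_iff hb0).1 hb.1.1) hb.1.2.ge hξ
  have hd : ∀ ξ, ξb < ξ → DifferentiableAt ℝ (U.F P) ξ := fun ξ hξ =>
    (hasDerivAt_F_of_causal hH hP hD (hb0.trans hξ) (hfb ξ hξ)).differentiableAt
  have hpos : ∀ ξ, ξb < ξ → 0 < deriv (U.F P) ξ := fun ξ hξ =>
    deriv_F_pos hH hP hD (hb0.trans hξ) (hfb ξ hξ)
  have hmono := strictMonoOn_Ioi_of_deriv_pos hd hpos
  have hFc : U.F P ξc ≤ 0 := by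
    have := F_lt_fc_div hH hP hD (hb0.trans hbc) (hfb ξc hbc)
    rw [hc.1.2, zero_div] at this
    exact this.le
  obtain ⟨η, hη, hFη⟩ := exists_F_pos hH hP hD (hb0.trans hbc) (hfb ξc hbc)
  obtain ⟨ξs, hs, hFs⟩ := intermediate_value_Icc hη.le
    (fun ξ hξ => (hd ξ (hbc.trans_le hξ.1)).continuousAt.continuousWithinAt) ⟨hFc, hFη.le⟩
  have hbs : ξb < ξs := hbc.trans_le hs.1
  refine ⟨ξs, ⟨⟨hbs, hFs⟩, fun y hy hFy => hmono.injOn hy hbs (hFy.trans hFs.symm)⟩,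
    fun ξ₀ h₀ => ?_⟩
  -- Both initial guesses lie in `(ξ_b, ξ_*]`.
  obtain ⟨hbξ₀, hξ₀s⟩ : ξb < ξ₀ ∧ ξ₀ ≤ ξs := by
    rcases h₀ with rfl | rfl
    · unfold hybrid
      split_ifs with hF
      · have hbd := hbc.trans hcd
        exact ⟨hbd, (hmono.le_iff_le hbd hbs).1 (by rwa [hFs])⟩
      · exact ⟨hbc, hs.1⟩
    · exact ⟨hbc, hs.1⟩
  have hlt := lt_newton hd hpos hbs hFs hshape hbξ₀ hξ₀s
  have hlim := tendsto_newton hd hpos hbs hFs hshape hbξ₀ hξ₀s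
  refine ⟨fun n => ⟨hd _ (hlt n), (hpos _ (hlt n)).ne'⟩, fun n => ?_, hlim, fun h2 =>
    quadraticRate_newton hd hpos hbs hFs
      (differentiableAt_deriv_F hH hP hD h2 (hb0.trans hbs) (hfb ξs hbs)) hlim⟩
  have hn0 := hb0.trans (hlt n)
  have hnb := hfb _ (hlt n)
  have hnu := invWSq_pos_of_fb_pos hn0 hnb
  exact ⟨(mem_Omega1_iff hn0).2 hnu, dens_pos hD hn0 hnu, pres_pos hH hP hD hn0 hnb,
    norm_vel_lt_one hn0 hnu⟩

end ConsState

end RMHD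

theorem theorem3p4 (U : RMHD.ConsState) (hU : U ∈ RMHD.ConsState.admissible) :
    -- the points `ξ_b` and `ξ_c` exist and are unique
    ∃ ξb ξc : ℝ, RMHD.IsUniqueRoot U.fb U.Omega1 ξb ∧ RMHD.IsUniqueRoot U.fc (Set.Ioi 0) ξc ∧
      -- the `γ`-law equation of state
      (∀ γ : ℝ, 1 < γ → γ ≤ 2 →
        ∀ P : ℝ → ℝ → ℝ, RMHD.IsPressureForm (RMHD.gammaLaw γ) P →
          ∃ ξs : ℝ, RMHD.IsUniqueRoot (U.F P) (Set.Ioi ξb) ξs ∧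
            ∀ ξ₀ : ℝ, (ξ₀ = U.hybrid P ξc ∨ ξ₀ = ξc) →
              RMHD.NewtonWellDefined (U.F P) (RMHD.newton (U.F P) ξ₀) ∧
              U.PCP P (RMHD.newton (U.F P) ξ₀) ∧
              Filter.Tendsto (RMHD.newton (U.F P) ξ₀) Filter.atTop (nhds ξs) ∧
              RMHD.QuadraticRate (RMHD.newton (U.F P) ξ₀) ξs) ∧
      -- a general equation of state
      (∀ H : ℝ → ℝ → ℝ, RMHD.CausalEOS H →
        ∀ P : ℝ → ℝ → ℝ, RMHD.IsPressureForm H P →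
          RMHD.DerivMonotoneOrOneInflection (U.F P) ξb →
          ∃ ξs : ℝ, RMHD.IsUniqueRoot (U.F P) (Set.Ioi ξb) ξs ∧
            ∀ ξ₀ : ℝ, (ξ₀ = U.hybrid P ξc ∨ ξ₀ = ξc) →
              RMHD.NewtonWellDefined (U.F P) (RMHD.newton (U.F P) ξ₀) ∧
              U.PCP P (RMHD.newton (U.F P) ξ₀) ∧
              Filter.Tendsto (RMHD.newton (U.F P) ξ₀) Filter.atTop (nhds ξs) ∧
              (RMHD.TwiceDifferentiableEOS H →
                RMHD.QuadraticRate (RMHD.newton (U.F P) ξ₀) ξs)) := by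
  obtain ⟨ξc, hc, hcd⟩ := RMHD.ConsState.exists_isUniqueRoot_fc hU
  have hD : 0 < U.D := hU.1
  obtain ⟨ξb, hb, hbc⟩ := RMHD.ConsState.exists_isUniqueRoot_fb hD hc.1.1
    (RMHD.ConsState.fb_pos_of_fc_eq_zero hU hc.1.1 hc.1.2 hcd)
  have hb0 : 0 < ξb := hb.1.1.1
  have hfb : ∀ ξ, ξb < ξ → 0 < U.fb ξ := fun ξ hξ => RMHD.ConsState.fb_pos_of_lt hb0
    ((RMHD.ConsState.mem_Omega1_iff hb0).1 hb.1.1) hb.1.2.ge hξ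
  refine ⟨ξb, ξc, hb, hc, fun γ h1 h2 P hP => ?_, fun H hH P hP hshape =>
    RMHD.ConsState.newton_F_converges hH hP hD hb hc hbc hcd hshape⟩
  obtain ⟨ξs, hs, hnewton⟩ := RMHD.ConsState.newton_F_converges (RMHD.gammaLaw_causal h1 h2) hP hD
    hb hc hbc hcd
    (RMHD.ConsState.derivMonotoneOrOneInflection_F_gammaLaw h1 h2 hP hD hb0.le hfb)
  refine ⟨ξs, hs, fun ξ₀ h₀ => ?_⟩
  obtain ⟨hwd, hpcp, hlim, hquad⟩ := hnewton ξ₀ h₀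
  exact ⟨hwd, hpcp, hlim, hquad (RMHD.gammaLaw_twiceDifferentiable h1)⟩
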